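/- Theorem 4.4. Let $d\ge 0$ be an integer and $s>0$. Write $(u,\phi)$ for the action of $u\in\mathscr S'(\mathbf R^n)$ on $\phi\in\mathscr S(\mathbf R^n)$ that is conjugate linear in $\phi$ and consistent with the $L^2$ inner product. For a window $\varphi\in\mathscr S(\mathbf R^n)\setminus\{0\}$ and $u\in\mathscr S'(\mathbf R^n)$ let $$V_\varphi u(x,\xi)=(2\pi)^{-n/2}\,(u,\;e^{i\langle\cdot,\xi\rangle}\varphi(\cdot-x)),\qquad x,\xi\in\mathbf R^n,$$ be the short-time Fourier transform. The $s$-Gabor wave front set $\mathrm{WF}^s_{\rm g}(u)\subseteq T^*\mathbf R^n\setminus 0$ is the set of all $z_0\in T^*\mathbf R^n\setminus 0$ for which there is no open set $U\subseteq T^*\mathbf R^n$ such that $z_0\in U$ and $$\sup_{(x,\xi)\in U,\ \lambda>0}\lambda^N|V_\varphi u(\lambda x,\lambda^s\xi)|<\infty\quad\text{for all } N\ge 0.$$ This set does not depend on the window; below, each wave front set may be computed with its own arbitrary nonzero window. Let $K\in\mathscr S'(\mathbf R^{2d})$, and let $\mathscr K:\mathscr S(\mathbf R^d)\to\mathscr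 S'(\mathbf R^d)$ be the continuous linear operator defined by $$(\mathscr Kf,g)=(K,\,g\otimes\overline f),\qquad f,g\in\mathscr S(\mathbf R^d).$$ Suppose that $\mathrm{WF}^s_{\rm g}(K)\subseteq T^*\mathbf R^{2d}\setminus 0$ contains no point of the form $(x,0,\xi,0)$ and no point of the form $(0,y,0,-\eta)$ with $x,y,\xi,\eta\in\mathbf R^d$. Then $\mathscr K$ extends uniquely to a sequentially continuous linear operator $\mathscr K:\mathscr S'(\mathbf R^d)\to\mathscr S'(\mathbf R^d)$, and for every $u\in\mathscr S'(\mathbf R^d)$ $$\mathrm{WF}^s_{\rm g}(\mathscr Ku)\subseteq \mathrm{WF}^s_{\rm g}(K)'\circ\mathrm{WF}^s_{\rm g}(u):=\{(x,\xi)\in\mathbf R^{2d}:\ \exists\,(y,\eta)\in\mathrm{WF}^s_{\rm g}(u),\ (x,y,\xi,-\eta)\in\mathrm{WF}^s_{\rm g}(K)\}.$$ -/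

import Mathlib

open scoped SchwartzMap ContDiff

namespace GaborWF

noncomputable section

/-- The space `ℝ^d` with its Euclidean norm. -/
abbrev Rd (d : ℕ) : Type := EuclideanSpace ℝ (Fin d)

/-- The space `ℝ^{2d} = ℝ^d × ℝ^d`, with the Euclidean norm of the product. -/
abbrev R2d (d : ℕ) : Type := WithLp 2 (Rd d × Rd d)

section TimeFrequency

variable {V : Type*} [NormedAddCommGroup V] [InnerProductSpace ℝ V]

theorem hasTemperateGrowth_exp_mul_I :
    (fun t : ℝ ↦ Complex.exp ((t : ℂ) * Complex.I)).HasTemperateGrowth := by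
  refine ⟨(Complex.ofRealCLM.contDiff.mul contDiff_const).cexp, fun n ↦ ⟨0, 1, fun t ↦ ?_⟩⟩
  have key : iteratedDeriv n (fun t : ℝ ↦ Complex.exp ((t : ℂ) * Complex.I)) =
      fun t : ℝ ↦ Complex.I ^ n * Complex.exp ((t : ℂ) * Complex.I) := by
    induction n with
    | zero => simp
    | succ n ih =>
      rw [iteratedDeriv_succ, ih]
      funext t
      have h : HasDerivAt (fun t : ℝ ↦ Complex.exp ((t : ℂ) * Complex.I))
          (Complex.exp ((t : ℂ) * Complex.I) * (1 * Complex.I)) t :=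
        ((Complex.ofRealCLM.hasDerivAt (x := t)).mul_const Complex.I).cexp
      rw [(h.const_mul (Complex.I ^ n)).deriv]
      ring
  rw [norm_iteratedFDeriv_eq_norm_iteratedDeriv, key]
  simp [Complex.norm_exp_ofReal_mul_I]

/-- The character `y ↦ e^{i⟨y, ξ⟩}`. -/
def character (ξ : V) (y : V) : ℂ := Complex.exp (((inner ℝ y ξ : ℝ) : ℂ) * Complex.I)

theorem hasTemperateGrowth_character (ξ : V) : (character ξ).HasTemperateGrowth :=
  hasTemperateGrowth_exp_mul_I.comp (Function.hasTemperateGrowth_inner_left ξ)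

/-- Translation `T_x f (y) = f (y - x)`. -/
def translation (x : V) : 𝓢(V, ℂ) →L[ℂ] 𝓢(V, ℂ) := SchwartzMap.compSubConstCLM ℂ x

/-- Modulation `M_ξ f (y) = e^{i⟨y, ξ⟩} f (y)`. -/
def modulation (ξ : V) : 𝓢(V, ℂ) →L[ℂ] 𝓢(V, ℂ) := SchwartzMap.smulLeftCLM ℂ (character ξ)

theorem translation_apply (x : V) (f : 𝓢(V, ℂ)) (y : V) : translation x f y = f (y - x) := rfl

theorem modulation_apply (ξ : V) (f : 𝓢(V, ℂ)) (y : V) :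
    modulation ξ f y = Complex.exp (((inner ℝ y ξ : ℝ) : ℂ) * Complex.I) * f y := by
  simp [modulation, hasTemperateGrowth_character, character]

/-- The complex conjugate of a Schwartz function. -/
def conjugate (f : 𝓢(V, ℂ)) : 𝓢(V, ℂ) :=
  SchwartzMap.postcompCLM (𝕜 := ℝ) (Complex.conjCLE : ℂ →L[ℝ] ℂ) f

theorem conjugate_apply (f : 𝓢(V, ℂ)) (y : V) :
    conjugate f y = (starRingEnd ℂ) (f y) := rfl

/-- The sesquilinear action `(u, φ)` of a tempered distribution on a test function. It extends
the `L²` inner product that is conjugate linear in the second argument; Mathlib's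
action `u φ` is linear in `φ`. -/
def action (u : 𝓢'(V, ℂ)) (φ : 𝓢(V, ℂ)) : ℂ := u (conjugate φ)

/-- The short-time Fourier transform
`V_φ u (x, ξ) = (2π)^{-n/2} (u, M_ξ T_x φ)`, where `n = dim V`. -/
def stft (φ : 𝓢(V, ℂ)) (u : 𝓢'(V, ℂ)) (x ξ : V) : ℂ :=
  (((2 * Real.pi) ^ (-(Module.finrank ℝ V : ℝ) / 2) : ℝ) : ℂ) *
    action u (modulation ξ (translation x φ))

/-- The `s`-Gabor wave front set of `u`, computed with the window `φ`,
as a subset of `T^*V \ 0`. -/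
def wavefront (s : ℝ) (φ : 𝓢(V, ℂ)) (u : 𝓢'(V, ℂ)) : Set (V × V) :=
  {z₀ | z₀ ≠ 0 ∧ ¬ ∃ U : Set (V × V), IsOpen U ∧ z₀ ∈ U ∧
    ∀ N : ℕ, ∃ C : ℝ, ∀ z ∈ U, ∀ l : ℝ, 0 < l →
      l ^ N * ‖stft φ u (l • z.1) (l ^ s • z.2)‖ ≤ C}

end TimeFrequency

section Tensor

variable {E F : Type*} [NormedAddCommGroup E] [NormedSpace ℝ E]
  [NormedAddCommGroup F] [NormedSpace ℝ F]

theorem norm_iteratedFDeriv_comp_le {G : Type*} [NormedAddCommGroup G] [NormedSpace ℝ G]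
    (L : G →L[ℝ] E) (hL : ‖L‖ ≤ 1) (g : 𝓢(E, ℂ)) (i : ℕ) (z : G) :
    ‖iteratedFDeriv ℝ i (fun z ↦ g (L z)) z‖ ≤ ‖iteratedFDeriv ℝ i g (L z)‖ := by
  have h := L.iteratedFDeriv_comp_right (f := g) (n := ∞) (g.smooth ⊤) z (i := i)
    (by exact_mod_cast le_top)
  change ‖iteratedFDeriv ℝ i (g ∘ L) z‖ ≤ _
  rw [h]
  refine (ContinuousMultilinearMap.norm_compContinuousLinearMap_le _ _).trans ?_
  refine mul_le_of_le_one_right (norm_nonneg _) ?_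
  simpa using pow_le_one₀ (norm_nonneg _) hL

theorem tensor_bound (k n : ℕ) (g : 𝓢(E, ℂ)) (f : 𝓢(F, ℂ)) (z : WithLp 2 (E × F)) :
    ‖z‖ ^ k * ‖iteratedFDeriv ℝ n (fun z : WithLp 2 (E × F) ↦ g z.fst * f z.snd) z‖ ≤
      2 ^ n * ((2 ^ k * (Finset.Iic (k, n)).sup (schwartzSeminormFamily ℂ E ℂ) g) *
        (2 ^ k * (Finset.Iic (k, n)).sup (schwartzSeminormFamily ℂ F ℂ) f)) := by
  let L₁ : WithLp 2 (E × F) →L[ℝ] E := WithLp.fstL 2 ℝ E F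
  let L₂ : WithLp 2 (E × F) →L[ℝ] F := WithLp.sndL 2 ℝ E F
  have hL₁ : ‖L₁‖ ≤ 1 := L₁.opNorm_le_bound zero_le_one fun z ↦ by
    rw [one_mul]; exact WithLp.norm_fst_le (p := 2) E z
  have hL₂ : ‖L₂‖ ≤ 1 := L₂.opNorm_le_bound zero_le_one fun z ↦ by
    rw [one_mul]; exact WithLp.norm_snd_le (p := 2) E z
  set A := 2 ^ k * (Finset.Iic (k, n)).sup (schwartzSeminormFamily ℂ E ℂ) g
  set B := 2 ^ k * (Finset.Iic (k, n)).sup (schwartzSeminormFamily ℂ F ℂ) f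
  have hz : ‖z‖ ≤ (1 + ‖z.fst‖) * (1 + ‖z.snd‖) := by
    have h := WithLp.prod_norm_sq_eq_of_L2 z
    have h1 := norm_nonneg z.fst
    have h2 := norm_nonneg z.snd
    refine abs_le_of_sq_le_sq' ?_ (by positivity) |>.2
    rw [h]
    nlinarith [mul_nonneg h1 h2, mul_nonneg (mul_nonneg h1 h2) (mul_nonneg h1 h2),
      mul_nonneg (mul_nonneg h1 h2) h1, mul_nonneg (mul_nonneg h1 h2) h2]
  have hs₁ : ContDiff ℝ ∞ (fun z ↦ g (L₁ z)) := (g.smooth ⊤).comp L₁.contDiff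
  have hs₂ : ContDiff ℝ ∞ (fun z ↦ f (L₂ z)) := (f.smooth ⊤).comp L₂.contDiff
  have hmul := norm_iteratedFDeriv_mul_le hs₁ hs₂ z (n := n) (by exact_mod_cast le_top)
  have hterm : ∀ i ∈ Finset.range (n + 1),
      ‖z‖ ^ k * ((n.choose i : ℝ) * ‖iteratedFDeriv ℝ i (fun z ↦ g (L₁ z)) z‖ *
        ‖iteratedFDeriv ℝ (n - i) (fun z ↦ f (L₂ z)) z‖) ≤ (n.choose i : ℝ) * (A * B) := by
    intro i hi
    have hi' : i ≤ n := Nat.lt_succ_iff.mp (Finset.mem_range.mp hi)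
    have h1 : (1 + ‖z.fst‖) ^ k * ‖iteratedFDeriv ℝ i g z.fst‖ ≤ A :=
      SchwartzMap.one_add_le_sup_seminorm_apply (𝕜 := ℂ) (m := (k, n)) le_rfl hi' g z.fst
    have h2 : (1 + ‖z.snd‖) ^ k * ‖iteratedFDeriv ℝ (n - i) f z.snd‖ ≤ B :=
      SchwartzMap.one_add_le_sup_seminorm_apply (𝕜 := ℂ) (m := (k, n)) le_rfl
        (Nat.sub_le n i) f z.snd
    have e1 : ‖iteratedFDeriv ℝ i (fun z ↦ g (L₁ z)) z‖ ≤ ‖iteratedFDeriv ℝ i g z.fst‖ :=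
      norm_iteratedFDeriv_comp_le L₁ hL₁ g i z
    have e2 : ‖iteratedFDeriv ℝ (n - i) (fun z ↦ f (L₂ z)) z‖ ≤
        ‖iteratedFDeriv ℝ (n - i) f z.snd‖ :=
      norm_iteratedFDeriv_comp_le L₂ hL₂ f (n - i) z
    calc _ ≤ ((1 + ‖z.fst‖) * (1 + ‖z.snd‖)) ^ k *
            ((n.choose i : ℝ) * ‖iteratedFDeriv ℝ i g z.fst‖ *
              ‖iteratedFDeriv ℝ (n - i) f z.snd‖) := by gcongr
      _ = (n.choose i : ℝ) * (((1 + ‖z.fst‖) ^ k * ‖iteratedFDeriv ℝ i g z.fst‖) *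
            ((1 + ‖z.snd‖) ^ k * ‖iteratedFDeriv ℝ (n - i) f z.snd‖)) := by
          rw [mul_pow]; ring
      _ ≤ _ := by
          have : 0 ≤ A := le_trans (by positivity) h1
          gcongr
  calc _ ≤ ‖z‖ ^ k * _ := by
        exact mul_le_mul_of_nonneg_left hmul (by positivity)
    _ = ∑ i ∈ Finset.range (n + 1), _ := Finset.mul_sum _ _ _
    _ ≤ ∑ i ∈ Finset.range (n + 1), (n.choose i : ℝ) * (A * B) := Finset.sum_le_sum hterm
    _ = 2 ^ n * (A * B) := by
      rw [← Finset.sum_mul]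
      congr 1
      exact_mod_cast Nat.sum_range_choose n

theorem tensor_contDiff (g : 𝓢(E, ℂ)) (f : 𝓢(F, ℂ)) :
    ContDiff ℝ ∞ (fun z : WithLp 2 (E × F) ↦ g z.fst * f z.snd) :=
  ((g.smooth ⊤).comp (WithLp.fstL 2 ℝ E F).contDiff).mul
    ((f.smooth ⊤).comp (WithLp.sndL 2 ℝ E F).contDiff)

/-- The tensor product `(g ⊗ f)(x, y) = g x * f y`, as a continuous linear map of `g`. -/
def tensorLeft (f : 𝓢(F, ℂ)) : 𝓢(E, ℂ) →L[ℂ] 𝓢(WithLp 2 (E × F), ℂ) :=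
  SchwartzMap.mkCLM (fun g z ↦ g z.fst * f z.snd)
    (fun _ _ _ ↦ by simp [add_mul]) (fun _ _ _ ↦ by simp [mul_assoc])
    (fun g ↦ tensor_contDiff g f) fun ⟨k, n⟩ ↦
      ⟨Finset.Iic (k, n), 2 ^ n * (2 ^ k *
        (2 ^ k * (Finset.Iic (k, n)).sup (schwartzSeminormFamily ℂ F ℂ) f)),
        by positivity, fun g z ↦ (tensor_bound k n g f z).trans_eq (by ring)⟩

/-- The tensor product `(g ⊗ f)(x, y) = g x * f y`, as a continuous linear map of `f`. -/
def tensorRight (g : 𝓢(E, ℂ)) : 𝓢(F, ℂ) →L[ℂ] 𝓢(WithLp 2 (E × F), ℂ) :=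
  SchwartzMap.mkCLM (fun f z ↦ g z.fst * f z.snd)
    (fun _ _ _ ↦ by simp [mul_add]) (fun _ _ _ ↦ by simp [mul_left_comm])
    (fun f ↦ tensor_contDiff g f) fun ⟨k, n⟩ ↦
      ⟨Finset.Iic (k, n), 2 ^ n * ((2 ^ k *
        (Finset.Iic (k, n)).sup (schwartzSeminormFamily ℂ E ℂ) g) * 2 ^ k),
        by positivity, fun f z ↦ (tensor_bound k n g f z).trans_eq (by ring)⟩

/-- The tensor product `(g ⊗ f)(x, y) = g x * f y` of Schwartz functions. -/
def tensor (g : 𝓢(E, ℂ)) (f : 𝓢(F, ℂ)) : 𝓢(WithLp 2 (E × F), ℂ) := tensorLeft f g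

theorem tensor_apply (g : 𝓢(E, ℂ)) (f : 𝓢(F, ℂ)) (z : WithLp 2 (E × F)) :
    tensor g f z = g z.fst * f z.snd := rfl

end Tensor

section Kernel

variable {d : ℕ}

/-- The continuous linear operator `𝒦 : 𝓢(ℝ^d) → 𝓢'(ℝ^d)` with Schwartz kernel `K`; in terms
of the linear action of distributions it reads `(𝒦 f)(g) = K (g ⊗ f)`. -/
def kernelOp (K : 𝓢'(R2d d, ℂ)) : 𝓢(Rd d, ℂ) →L[ℂ] 𝓢'(Rd d, ℂ) where
  toFun f := PointwiseConvergenceCLM.precomp ℂ (tensorLeft f) K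
  map_add' f₁ f₂ := by
    ext g
    exact (congrArg K (map_add (tensorRight g) f₁ f₂)).trans (map_add K _ _)
  map_smul' c f := by
    ext g
    exact (congrArg K (map_smul (tensorRight g) c f)).trans (map_smul K _ _)
  cont := PointwiseConvergenceCLM.continuous_of_continuous_eval fun g ↦
    K.continuous.comp (tensorRight g).continuous

theorem kernelOp_apply (K : 𝓢'(R2d d, ℂ)) (f g : 𝓢(Rd d, ℂ)) :
    kernelOp K f g = K (tensor g f) := rfl

/-- In terms of the sesquilinear action, `(𝒦 f, g) = (K, g ⊗ conj f)`. -/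
theorem action_kernelOp (K : 𝓢'(R2d d, ℂ)) (f g : 𝓢(Rd d, ℂ)) :
    action (kernelOp K f) g = action K (tensor g (conjugate f)) := by
  change K (tensor (conjugate g) f) = K (conjugate (tensor g (conjugate f)))
  congr 1
  ext z
  simp [tensor_apply, conjugate_apply]

/-- `T` is a sequentially continuous linear operator on `𝓢'(ℝ^d)` that extends `𝒦`, where
`𝓢(ℝ^d)` is embedded in `𝓢'(ℝ^d)` by integration. -/
structure IsExtension (K : 𝓢'(R2d d, ℂ)) (T : 𝓢'(Rd d, ℂ) →ₗ[ℂ] 𝓢'(Rd d, ℂ)) : Prop where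
  seqContinuous : SeqContinuous T
  extends_kernelOp : ∀ f : 𝓢(Rd d, ℂ),
    T (SchwartzMap.toTemperedDistributionCLM (Rd d) ℂ MeasureTheory.volume f) = kernelOp K f

/-- The point `(x, y, ξ, η)` of `T^*ℝ^{2d}`, with base point `(x, y)` and covector `(ξ, η)`. -/
def phasePoint (x y ξ η : Rd d) : R2d d × R2d d := (WithLp.toLp 2 (x, y), WithLp.toLp 2 (ξ, η))

/-- The set of `(x, ξ)` such that `(x, 0, ξ, 0) ∈ A`. -/
def firstAxis (A : Set (R2d d × R2d d)) : Set (Rd d × Rd d) :=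
  {z | phasePoint z.1 0 z.2 0 ∈ A}

/-- The set of `(y, η)` such that `(0, y, 0, -η) ∈ A`. -/
def secondAxis (A : Set (R2d d × R2d d)) : Set (Rd d × Rd d) :=
  {z | phasePoint 0 z.1 0 (-z.2) ∈ A}

/-- The relation mapping
`A' ∘ B = {(x, ξ) | ∃ (y, η) ∈ B, (x, y, ξ, -η) ∈ A}`. -/
def twistedComp (A : Set (R2d d × R2d d)) (B : Set (Rd d × Rd d)) : Set (Rd d × Rd d) :=
  {z | ∃ w ∈ B, phasePoint z.1 w.1 z.2 (-w.2) ∈ A}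

end Kernel

end

end GaborWF

/-!
Gabor coefficients reproduce: `u f` is a constant times `∫ windowCoeff φ f z * gaborCoeff φ u z`
over phase space. With a tensor window for `K` and the transposed operator `g ↦ K (g ⊗ ·)`, this
yields `(𝒦 u)(g) = c ∫ gaborCoeff χ (K (g ⊗ ·)) w * u (atom w χ) dw`. Since the wave front set of
`K` has no points `(0, y, 0, -η)`, the coefficients of `K` at `(z, w)` decay rapidly in `w`, with
polynomial growth in `z`; so the integral converges for every tempered `u` and defines the
extension, which is unique because Schwartz functions are sequentially dense in `𝓢'`.

The coefficient of `𝒦 u` at `z` is the integral of the kernel coefficient at `(z, w)` times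
`u (atom w χ)`. When `w` is large compared to `z` the kernel coefficient decays along the
anisotropic dilations. The remaining `w`, rescaled, range over a compact set, on which one of the
two factors decays unless `z` is related to a point of the wave front set of `u`; there `w = 0` is
covered by the absence of points `(x, 0, ξ, 0)`.
-/

open scoped FourierTransform
open MeasureTheory Filter Topology

namespace GaborWF

noncomputable section

/-! ### Time-frequency shifts of Schwartz functions -/

section SchwartzSeminorms

variable {E F : Type*} [NormedAddCommGroup E] [NormedSpace ℝ E] [NormedAddCommGroup F]
  [NormedSpace ℝ F] [NormedSpace ℂ F] [SMulCommClass ℝ ℂ F]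

theorem exists_le_sup_seminorm (p : Seminorm ℂ 𝓢(E, F)) (hp : Continuous p) :
    ∃ (k n : ℕ) (C : NNReal), ∀ f, p f ≤
      C * (Finset.Iic (k, n)).sup (schwartzSeminormFamily ℂ E F) f := by
  obtain ⟨s, C, -, hC⟩ := Seminorm.bound_of_continuous (schwartz_withSeminorms ℂ E F) p hp
  have hs : s.sup (schwartzSeminormFamily ℂ E F) ≤
      (Finset.Iic (s.sup id)).sup (schwartzSeminormFamily ℂ E F) :=
    Finset.sup_mono fun i hi ↦ Finset.mem_Iic.2 (Finset.le_sup (f := id) hi)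
  exact ⟨(s.sup id).1, (s.sup id).2, C, fun f ↦
    (hC f).trans (mul_le_mul_of_nonneg_left (hs f) C.2)⟩

theorem continuous_sup_seminorm (s : Finset (ℕ × ℕ)) :
    Continuous (s.sup (schwartzSeminormFamily ℂ E F) : Seminorm ℂ 𝓢(E, F)) :=
  (schwartz_withSeminorms ℂ E F).finset_sups.continuous_seminorm s

end SchwartzSeminorms

section Translation

variable {V : Type*} [NormedAddCommGroup V] [InnerProductSpace ℝ V]

theorem iteratedFDeriv_translation (n : ℕ) (f : 𝓢(V, ℂ)) (x t : V) :
    iteratedFDeriv ℝ n (translation x f) t = iteratedFDeriv ℝ n f (t - x) :=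
  iteratedFDeriv_comp_sub n x t

theorem norm_pow_mul_norm_iteratedFDeriv_sub_le (k n : ℕ) (f : 𝓢(V, ℂ)) (t x : V) :
    ‖t‖ ^ k * ‖iteratedFDeriv ℝ n f (t - x)‖ ≤
      (1 + ‖x‖) ^ k * (2 ^ k * (Finset.Iic (k, n)).sup (schwartzSeminormFamily ℂ V ℂ) f) := by
  have hf := SchwartzMap.one_add_le_sup_seminorm_apply (𝕜 := ℂ) (m := (k, n)) le_rfl le_rfl f
    (t - x)
  have ht : ‖t‖ ≤ (1 + ‖x‖) * (1 + ‖t - x‖) := by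
    have : ‖t‖ ≤ ‖t - x‖ + ‖x‖ := by simpa only [sub_add_cancel] using norm_add_le (t - x) x
    nlinarith [norm_nonneg x, norm_nonneg (t - x), mul_nonneg (norm_nonneg x) (norm_nonneg (t - x))]
  calc _ ≤ ((1 + ‖x‖) * (1 + ‖t - x‖)) ^ k * ‖iteratedFDeriv ℝ n f (t - x)‖ := by gcongr
    _ = (1 + ‖x‖) ^ k * ((1 + ‖t - x‖) ^ k * ‖iteratedFDeriv ℝ n f (t - x)‖) := by
      rw [mul_pow]; ring
    _ ≤ _ := mul_le_mul_of_nonneg_left hf (by positivity)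

theorem sup_seminorm_translation_le (k n : ℕ) (f : 𝓢(V, ℂ)) (x : V) :
    (Finset.Iic (k, n)).sup (schwartzSeminormFamily ℂ V ℂ) (translation x f) ≤
      (1 + ‖x‖) ^ k * (2 ^ k * (Finset.Iic (k, n)).sup (schwartzSeminormFamily ℂ V ℂ) f) := by
  refine Seminorm.finset_sup_apply_le (by positivity) ?_
  rintro ⟨i, j⟩ hij
  obtain ⟨hi, -⟩ := Prod.mk_le_mk.1 (Finset.mem_Iic.1 hij)
  have hmono : (Finset.Iic (i, j)).sup (schwartzSeminormFamily ℂ V ℂ) f ≤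
      (Finset.Iic (k, n)).sup (schwartzSeminormFamily ℂ V ℂ) f :=
    Seminorm.le_def.1 (Finset.sup_mono (Finset.Iic_subset_Iic.2 (Finset.mem_Iic.1 hij))) f
  refine SchwartzMap.seminorm_le_bound ℂ i j _ (by positivity) fun t ↦ ?_
  rw [iteratedFDeriv_translation]
  refine (norm_pow_mul_norm_iteratedFDeriv_sub_le i j f t x).trans ?_
  gcongr
  · exact le_add_of_nonneg_right (norm_nonneg x)
  · exact one_le_two

theorem exists_seminorm_translation_le (p : Seminorm ℂ 𝓢(V, ℂ)) (hp : Continuous p) :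
    ∃ (q : Seminorm ℂ 𝓢(V, ℂ)) (m : ℕ), Continuous q ∧
      ∀ x f, p (translation x f) ≤ (1 + ‖x‖) ^ m * q f := by
  obtain ⟨k, n, C, hC⟩ := exists_le_sup_seminorm p hp
  set r := (Finset.Iic (k, n)).sup (schwartzSeminormFamily ℂ V ℂ)
  refine ⟨(C * 2 ^ k) • r, k, (continuous_sup_seminorm _).const_smul (C * 2 ^ k), fun x f ↦ ?_⟩
  calc p (translation x f) ≤ C * r (translation x f) := hC _
    _ ≤ C * ((1 + ‖x‖) ^ k * (2 ^ k * r f)) := by gcongr; exact sup_seminorm_translation_le k n f x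
    _ = (1 + ‖x‖) ^ k * ((C * 2 ^ k) * r f) := by ring

theorem norm_pow_mul_norm_iteratedFDeriv_sub_sub_le (k n : ℕ) (f : 𝓢(V, ℂ)) (t : V) {R : ℝ}
    {x y : V} (hx : ‖x‖ ≤ R) (hy : ‖y‖ ≤ R) :
    ‖t‖ ^ k * ‖iteratedFDeriv ℝ n f (t - x) - iteratedFDeriv ℝ n f (t - y)‖ ≤
      (1 + R) ^ k * (2 ^ k * (Finset.Iic (k, n + 1)).sup (schwartzSeminormFamily ℂ V ℂ) f) *
        ‖x - y‖ := by
  have hdiff (z : V) : DifferentiableAt ℝ (iteratedFDeriv ℝ n f) z :=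
    (f.smooth ⊤).differentiable_iteratedFDeriv (mod_cast ENat.natCast_lt_top n) z
  have hmem {z : V} (hz : ‖z‖ ≤ R) : t - z ∈ Metric.closedBall t R := by
    rwa [mem_closedBall_iff_norm', sub_sub_cancel]
  have := (convex_closedBall t R).norm_image_sub_le_of_norm_fderiv_le (𝕜 := ℝ)
    (C := (1 + R) ^ k * (2 ^ k * (Finset.Iic (k, n + 1)).sup (schwartzSeminormFamily ℂ V ℂ) f))
    (fun z _ ↦ (hdiff z).fun_const_smul (‖t‖ ^ k))
    (fun z hz ↦ ?_) (hmem hy) (hmem hx)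
  · rwa [← smul_sub, norm_smul, norm_pow, norm_norm, sub_sub_sub_cancel_left, norm_sub_rev y]
      at this
  · rw [fderiv_fun_const_smul (hdiff z), norm_smul, norm_fderiv_iteratedFDeriv, norm_pow, norm_norm,
      ← sub_sub_cancel t z]
    refine (norm_pow_mul_norm_iteratedFDeriv_sub_le k (n + 1) f t (t - z)).trans ?_
    gcongr
    exact mem_closedBall_iff_norm'.1 hz

theorem seminorm_translation_sub_translation_le (k n : ℕ) (f : 𝓢(V, ℂ)) {R : ℝ} {x y : V}
    (hx : ‖x‖ ≤ R) (hy : ‖y‖ ≤ R) :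
    SchwartzMap.seminorm ℂ k n (translation x f - translation y f) ≤
      (1 + R) ^ k * (2 ^ k * (Finset.Iic (k, n + 1)).sup (schwartzSeminormFamily ℂ V ℂ) f) *
        ‖x - y‖ := by
  have hR : 0 ≤ R := (norm_nonneg x).trans hx
  refine SchwartzMap.seminorm_le_bound ℂ k n _ (by positivity) fun t ↦ ?_
  have hsub : iteratedFDeriv ℝ n (translation x f - translation y f : 𝓢(V, ℂ)) t =
      iteratedFDeriv ℝ n f (t - x) - iteratedFDeriv ℝ n f (t - y) := by
    rw [← iteratedFDeriv_translation, ← iteratedFDeriv_translation]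
    exact iteratedFDeriv_sub_apply ((translation x f).contDiffAt n) ((translation y f).contDiffAt n)
  rw [hsub]
  exact norm_pow_mul_norm_iteratedFDeriv_sub_sub_le k n f t hx hy

theorem continuous_translation (f : 𝓢(V, ℂ)) : Continuous fun x ↦ translation x f := by
  refine continuous_iff_continuousAt.2 fun x₀ ↦ ?_
  rw [ContinuousAt, (schwartz_withSeminorms ℂ V ℂ).tendsto_nhds]
  rintro ⟨k, n⟩ ε hε
  set M := (1 + (‖x₀‖ + 1)) ^ k *
    (2 ^ k * (Finset.Iic (k, n + 1)).sup (schwartzSeminormFamily ℂ V ℂ) f)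
  have hM : Tendsto (fun x ↦ M * ‖x - x₀‖) (𝓝 x₀) (𝓝 0) := by
    simpa using (by fun_prop : Continuous fun x ↦ M * ‖x - x₀‖).tendsto x₀
  filter_upwards [hM.eventually_lt_const hε,
    continuous_norm.continuousAt.eventually_le_const (lt_add_one ‖x₀‖)] with x hx hx₀
  exact (seminorm_translation_sub_translation_le k n f hx₀ (le_add_of_nonneg_right
    zero_le_one)).trans_lt hx

/-- The time-frequency shift `M_ξ T_x φ` of a window by `z = (x, ξ)`. -/
def atom (z : V × V) (φ : 𝓢(V, ℂ)) : 𝓢(V, ℂ) := modulation z.2 (translation z.1 φ)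

theorem atom_apply (z : V × V) (φ : 𝓢(V, ℂ)) (t : V) :
    atom z φ t = Complex.exp (((inner ℝ t z.2 : ℝ) : ℂ) * Complex.I) * φ (t - z.1) :=
  modulation_apply _ _ _

theorem norm_atom_apply (z : V × V) (φ : 𝓢(V, ℂ)) (t : V) : ‖atom z φ t‖ = ‖φ (t - z.1)‖ := by
  rw [atom_apply, norm_mul, Complex.norm_exp_ofReal_mul_I, one_mul]

end Translation

section Modulation

variable {V : Type*} [NormedAddCommGroup V] [InnerProductSpace ℝ V] [FiniteDimensional ℝ V]
  [MeasurableSpace V] [BorelSpace V]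

theorem modulation_eq_fourierInv (ξ : V) (f : 𝓢(V, ℂ)) :
    modulation ξ f = 𝓕⁻ (translation ((2 * Real.pi)⁻¹ • ξ) (𝓕 f)) := by
  ext t
  have hf : f t = 𝓕⁻ (𝓕 f) t := by rw [FourierTransform.fourierInv_fourier_eq]
  rw [modulation_apply, hf, SchwartzMap.fourierInv_coe, SchwartzMap.fourierInv_coe,
    Real.fourierInv_eq', Real.fourierInv_eq', ← integral_const_mul,
    ← integral_sub_right_eq_self _ ((2 * Real.pi)⁻¹ • ξ)]
  congr 1
  ext w
  rw [translation_apply, smul_eq_mul, smul_eq_mul, ← mul_assoc, ← Complex.exp_add]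
  congr 2
  rw [← add_mul, ← Complex.ofReal_add, inner_sub_left, inner_smul_left, real_inner_comm]
  congr 2
  simp only [conj_trivial]
  field_simp [Real.pi_ne_zero]
  ring

theorem exists_seminorm_modulation_le (p : Seminorm ℂ 𝓢(V, ℂ)) (hp : Continuous p) :
    ∃ (q : Seminorm ℂ 𝓢(V, ℂ)) (m : ℕ), Continuous q ∧
      ∀ ξ f, p (modulation ξ f) ≤ (1 + ‖ξ‖) ^ m * q f := by
  let 𝓕₁ : 𝓢(V, ℂ) →L[ℂ] 𝓢(V, ℂ) := FourierTransform.fourierCLM ℂ 𝓢(V, ℂ)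
  let 𝓕₂ : 𝓢(V, ℂ) →L[ℂ] 𝓢(V, ℂ) := FourierTransform.fourierInvCLM ℂ 𝓢(V, ℂ)
  obtain ⟨q, m, hq, h⟩ := exists_seminorm_translation_le (p.comp 𝓕₂.toLinearMap)
    (hp.comp 𝓕₂.continuous)
  refine ⟨q.comp 𝓕₁.toLinearMap, m, hq.comp 𝓕₁.continuous, fun ξ f ↦ ?_⟩
  have hξ : ‖(2 * Real.pi)⁻¹ • ξ‖ ≤ ‖ξ‖ := by
    rw [norm_smul, Real.norm_of_nonneg (by positivity)]
    exact mul_le_of_le_one_left (norm_nonneg _)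
      (inv_le_one_of_one_le₀ (by linarith [Real.pi_gt_three]))
  calc p (modulation ξ f) = p.comp 𝓕₂.toLinearMap (translation ((2 * Real.pi)⁻¹ • ξ) (𝓕 f)) :=
      congrArg p (modulation_eq_fourierInv ξ f)
    _ ≤ (1 + ‖(2 * Real.pi)⁻¹ • ξ‖) ^ m * q (𝓕 f) := h _ _
    _ ≤ (1 + ‖ξ‖) ^ m * q (𝓕 f) := by gcongr

theorem continuous_modulation (f : 𝓢(V, ℂ)) : Continuous fun ξ ↦ modulation ξ f := by
  simp_rw [modulation_eq_fourierInv]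
  exact (FourierTransform.fourierInvCLM ℂ 𝓢(V, ℂ) (F := 𝓢(V, ℂ))).continuous.comp
    ((continuous_translation _).comp (continuous_const_smul _))

theorem exists_seminorm_atom_le (p : Seminorm ℂ 𝓢(V, ℂ)) (hp : Continuous p) :
    ∃ (q : Seminorm ℂ 𝓢(V, ℂ)) (m : ℕ), Continuous q ∧
      ∀ z φ, p (atom z φ) ≤ (1 + ‖z‖) ^ m * q φ := by
  obtain ⟨q, m, hq, hmod⟩ := exists_seminorm_modulation_le p hp
  obtain ⟨r, l, hr, htrans⟩ := exists_seminorm_translation_le q hq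
  refine ⟨r, m + l, hr, fun z φ ↦ ?_⟩
  calc p (atom z φ) ≤ (1 + ‖z.2‖) ^ m * q (translation z.1 φ) := hmod _ _
    _ ≤ (1 + ‖z.2‖) ^ m * ((1 + ‖z.1‖) ^ l * r φ) := by gcongr; exact htrans _ _
    _ ≤ (1 + ‖z‖) ^ m * ((1 + ‖z‖) ^ l * r φ) := by
      gcongr (1 + ?_) ^ m * ((1 + ?_) ^ l * r φ)
      exacts [norm_snd_le z, norm_fst_le z]
    _ = (1 + ‖z‖) ^ (m + l) * r φ := by ring

theorem continuous_atom (φ : 𝓢(V, ℂ)) : Continuous fun z : V × V ↦ atom z φ := by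
  refine continuous_iff_continuousAt.2 fun z₀ ↦ ?_
  rw [ContinuousAt, (schwartz_withSeminorms ℂ V ℂ).tendsto_nhds]
  intro i ε hε
  set p := schwartzSeminormFamily ℂ V ℂ i
  have hp : Continuous p := (schwartz_withSeminorms ℂ V ℂ).continuous_seminorm i
  obtain ⟨q, m, hq, hmod⟩ := exists_seminorm_modulation_le p hp
  have hcont : Continuous fun z : V × V ↦
      (1 + ‖z.2‖) ^ m * q (translation z.1 φ - translation z₀.1 φ) +
        p (modulation z.2 (translation z₀.1 φ) - modulation z₀.2 (translation z₀.1 φ)) := by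
    have := continuous_translation φ
    have := continuous_modulation (translation z₀.1 φ)
    fun_prop
  have hlim := hcont.tendsto z₀
  simp only [sub_self, map_zero, mul_zero, add_zero] at hlim
  filter_upwards [hlim.eventually_lt_const hε] with z hz
  have hsub : atom z φ - atom z₀ φ = modulation z.2 (translation z.1 φ - translation z₀.1 φ) +
      (modulation z.2 (translation z₀.1 φ) - modulation z₀.2 (translation z₀.1 φ)) := by
    simp only [atom, map_sub, sub_add_sub_cancel]
  rw [hsub]
  exact ((map_add_le_add p _ _).trans (add_le_add_left (hmod _ _) _)).trans_lt hz

end Modulation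

/-! ### Weak integrals of Schwartz functions -/

section SchwartzIntegral

open scoped ENNReal

variable {E : Type*} [NormedAddCommGroup E] [NormedSpace ℝ E]

/-- The bounded function `t ↦ ‖t‖ ^ k • D^n f t`, whose supremum norm is the Schwartz seminorm of
`f` with index `(k, n)`. It maps the Schwartz space to a Banach space, where Bochner integrals are
available. -/
def weightedDeriv (k n : ℕ) : 𝓢(E, ℂ) →L[ℂ] lp (fun _ : E ↦ E [×n]→L[ℝ] ℂ) ∞ :=
  have hbound (f : 𝓢(E, ℂ)) (t : E) :
      ‖‖t‖ ^ k • iteratedFDeriv ℝ n f t‖ ≤ SchwartzMap.seminorm ℂ k n f := by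
    rw [norm_smul, norm_pow, norm_norm]
    exact SchwartzMap.le_seminorm ℂ k n f t
  SchwartzMap.mkCLMtoNormedSpace
    (fun f ↦ ⟨fun t ↦ ‖t‖ ^ k • iteratedFDeriv ℝ n f t,
      memℓp_infty ⟨_, Set.forall_mem_range.2 (hbound f)⟩⟩)
    (fun f g ↦ Subtype.ext <| funext fun t ↦ (congrArg (‖t‖ ^ k • ·)
      (iteratedFDeriv_add_apply (f.contDiffAt n) (g.contDiffAt n))).trans (smul_add _ _ _))
    (fun c f ↦ Subtype.ext <| funext fun t ↦ (congrArg (‖t‖ ^ k • ·)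
      (iteratedFDeriv_const_smul_apply (f.contDiffAt n))).trans (smul_comm _ _ _))
    ⟨{(k, n)}, 1, zero_le_one, fun f ↦ by
      rw [one_mul, Finset.sup_singleton]
      exact lp.norm_le_of_forall_le (apply_nonneg _ f) (hbound f)⟩

theorem weightedDeriv_apply (k n : ℕ) (f : 𝓢(E, ℂ)) (t : E) :
    weightedDeriv k n f t = ‖t‖ ^ k • iteratedFDeriv ℝ n f t := rfl

theorem norm_weightedDeriv (k n : ℕ) (f : 𝓢(E, ℂ)) :
    ‖weightedDeriv k n f‖ = SchwartzMap.seminorm ℂ k n f := by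
  refine le_antisymm (lp.norm_le_of_forall_le (apply_nonneg _ f) fun t ↦ ?_)
    (SchwartzMap.seminorm_le_bound ℂ k n f (norm_nonneg _) fun t ↦ ?_)
  · rw [weightedDeriv_apply, norm_smul, norm_pow, norm_norm]
    exact SchwartzMap.le_seminorm ℂ k n f t
  · have := lp.norm_apply_le_norm ENNReal.top_ne_zero (weightedDeriv k n f) t
    rwa [weightedDeriv_apply, norm_smul, norm_pow, norm_norm] at this

theorem exists_continuous_factor {X B : Type*} [AddCommGroup X] [Module ℂ X]
    [NormedAddCommGroup B] [NormedSpace ℂ B] (J : X →ₗ[ℂ] B) (u : X →ₗ[ℂ] ℂ) (C : ℝ)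
    (h : ∀ f, ‖u f‖ ≤ C * ‖J f‖) : ∃ L : B →L[ℂ] ℂ, ∀ f, L (J f) = u f := by
  have hker : u ∈ J.dualMap.range := by
    rw [LinearMap.range_dualMap_eq_dualAnnihilator_ker, Submodule.mem_dualAnnihilator]
    intro f hf
    simpa only [LinearMap.mem_ker.1 hf, norm_zero, mul_zero, norm_le_zero_iff] using h f
  obtain ⟨l, rfl⟩ := hker
  let l₀ : StrongDual ℂ J.range := (l.domRestrict J.range).mkContinuous C <| by
    rintro ⟨-, f, rfl⟩
    exact h f
  obtain ⟨L, hL, -⟩ := exists_extension_norm_eq J.range l₀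
  exact ⟨L, fun f ↦ hL ⟨J f, LinearMap.mem_range_self J f⟩⟩

variable {Z : Type*} [TopologicalSpace Z] [SecondCountableTopology Z] [MeasurableSpace Z]
  [OpensMeasurableSpace Z] {μ : Measure Z} {H : Z → ℂ} {F : Z → 𝓢(E, ℂ)}

/-- The absolute convergence of the superposition `∫ H z • F z ∂μ` in the Schwartz space: all
Schwartz seminorms of the integrand are integrable. -/
structure SchwartzIntegrable (μ : Measure Z) (H : Z → ℂ) (F : Z → 𝓢(E, ℂ)) : Prop where
  aestronglyMeasurable : AEStronglyMeasurable H μ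
  continuous : Continuous F
  integrable : ∀ k n, Integrable (fun z ↦ ‖H z‖ * SchwartzMap.seminorm ℂ k n (F z)) μ

theorem integrable_smul_weightedDeriv (hI : SchwartzIntegrable μ H F) (k n : ℕ) :
    Integrable (fun z ↦ H z • weightedDeriv k n (F z)) μ := by
  refine (hI.integrable k n).mono' (hI.aestronglyMeasurable.smul
    ((weightedDeriv k n).continuous.comp hI.continuous).aestronglyMeasurable)
    (ae_of_all _ fun z ↦ ?_)
  rw [norm_smul, norm_weightedDeriv]

theorem integral_smul_weightedDeriv_apply (hI : SchwartzIntegrable μ H F) (k n : ℕ)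
    (t : E) : (∫ z, H z • weightedDeriv k n (F z) ∂μ : lp (fun _ : E ↦ E [×n]→L[ℝ] ℂ) ∞) t =
      ‖t‖ ^ k • ∫ z, H z • iteratedFDeriv ℝ n (F z) t ∂μ := by
  have := (lp.evalCLM ℂ (fun _ : E ↦ E [×n]→L[ℝ] ℂ) ∞ t).integral_comp_comm
    (integrable_smul_weightedDeriv hI k n)
  rw [← integral_smul]
  refine this.symm.trans (integral_congr_ae (ae_of_all _ fun z ↦ ?_))
  exact smul_comm (H z) (‖t‖ ^ k) (iteratedFDeriv ℝ n (F z) t)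

theorem integrable_smul_iteratedFDeriv (hI : SchwartzIntegrable μ H F) (n : ℕ)
    (t : E) : Integrable (fun z ↦ H z • iteratedFDeriv ℝ n (F z) t) μ := by
  refine ((lp.evalCLM ℂ (fun _ : E ↦ E [×n]→L[ℝ] ℂ) ∞ t).integrable_comp
    (integrable_smul_weightedDeriv hI 0 n)).congr (ae_of_all _ fun z ↦ ?_)
  change H z • (‖t‖ ^ 0 • iteratedFDeriv ℝ n (F z) t) = _
  rw [pow_zero, one_smul]

theorem SchwartzIntegrable.integrable_mul_apply (hI : SchwartzIntegrable μ H F) (t : E) :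
    Integrable (fun z ↦ H z * F z t) μ :=
  (ContinuousMultilinearMap.apply ℝ (fun _ : Fin 0 ↦ E) ℂ 0).integrable_comp
    (integrable_smul_iteratedFDeriv hI 0 t)

theorem norm_smul_iteratedFDeriv_le (c : ℂ) (n : ℕ) (f : 𝓢(E, ℂ)) (t : E) :
    ‖c • iteratedFDeriv ℝ n f t‖ ≤ ‖c‖ * SchwartzMap.seminorm ℂ 0 n f := by
  rw [norm_smul]
  gcongr
  exact SchwartzMap.norm_iteratedFDeriv_le_seminorm ℂ f n t

theorem hasFTaylorSeriesUpTo_integral (hI : SchwartzIntegrable μ H F) :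
    HasFTaylorSeriesUpTo ∞ (fun t ↦ ∫ z, H z • F z t ∂μ)
      (fun t n ↦ ∫ z, H z • iteratedFDeriv ℝ n (F z) t ∂μ) where
  zero_eq t := ((ContinuousMultilinearMap.apply ℝ (fun _ : Fin 0 ↦ E) ℂ 0).integral_comp_comm
    (integrable_smul_iteratedFDeriv hI 0 t)).symm
  fderiv m _ t := by
    have hi := integrable_smul_iteratedFDeriv hI (m + 1)
    let L := continuousMultilinearCurryLeftEquiv ℝ (fun _ : Fin (m + 1) ↦ E) ℂ
    let L' : (E [×(m + 1)]→L[ℝ] ℂ) →L[ℝ] (E →L[ℝ] (E [×m]→L[ℝ] ℂ)) := L.toContinuousLinearEquiv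
    have hcurry : ∫ z, L (H z • iteratedFDeriv ℝ (m + 1) (F z) t) ∂μ =
        (∫ z, H z • iteratedFDeriv ℝ (m + 1) (F z) t ∂μ).curryLeft :=
      ContinuousLinearMap.integral_comp_comm (𝕜 := ℝ) (E := E [×(m + 1)]→L[ℝ] ℂ)
        (Fₗ := E →L[ℝ] (E [×m]→L[ℝ] ℂ)) L' (hi t)
    rw [← hcurry]
    refine hasFDerivAt_integral_of_dominated_of_fderiv_le (𝕜 := ℝ)
      (F' := fun t z ↦ L (H z • iteratedFDeriv ℝ (m + 1) (F z) t))
      (bound := fun z ↦ ‖H z‖ * SchwartzMap.seminorm ℂ 0 (m + 1) (F z)) univ_mem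
      (Eventually.of_forall fun y ↦
        (integrable_smul_iteratedFDeriv hI m y).aestronglyMeasurable)
      (integrable_smul_iteratedFDeriv hI m t)
      (L.continuous.comp_aestronglyMeasurable (hi t).aestronglyMeasurable)
      (ae_of_all _ fun z y _ ↦ ?_) (hI.integrable 0 (m + 1)) (ae_of_all _ fun z y _ ↦ ?_)
    · rw [LinearIsometryEquiv.norm_map]
      exact norm_smul_iteratedFDeriv_le (H z) (m + 1) (F z) y
    · exact (((F z).smooth ⊤).ftaylorSeries.fderiv m (mod_cast ENat.natCast_lt_top m)
        y).fun_const_smul (H z)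
  cont m _ := continuous_of_dominated
    (fun t ↦ (integrable_smul_iteratedFDeriv hI m t).aestronglyMeasurable)
    (fun t ↦ ae_of_all _ fun z ↦ norm_smul_iteratedFDeriv_le (H z) m (F z) t) (hI.integrable 0 m)
    (ae_of_all _ fun z ↦
      (((F z).smooth ⊤).continuous_iteratedFDeriv (mod_cast le_top)).fun_const_smul (H z))

theorem iteratedFDeriv_integral (hI : SchwartzIntegrable μ H F) (n : ℕ)
    (t : E) : iteratedFDeriv ℝ n (fun t ↦ ∫ z, H z • F z t ∂μ) t =
      ∫ z, H z • iteratedFDeriv ℝ n (F z) t ∂μ :=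
  ((hasFTaylorSeriesUpTo_integral hI).eq_iteratedFDeriv (mod_cast le_top) t).symm

/-- The superposition `∫ H z • F z ∂μ` of Schwartz functions as a Schwartz function. It is defined
pointwise, since Bochner integrals are not available in a Fréchet space. -/
def schwartzIntegral (hI : SchwartzIntegrable μ H F) : 𝓢(E, ℂ) where
  toFun t := ∫ z, H z • F z t ∂μ
  smooth' := (hasFTaylorSeriesUpTo_integral hI).contDiff
  decay' k n := by
    refine ⟨‖∫ z, H z • weightedDeriv k n (F z) ∂μ‖, fun t ↦ ?_⟩
    have := lp.norm_apply_le_norm ENNReal.top_ne_zero (∫ z, H z • weightedDeriv k n (F z) ∂μ) t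
    rwa [integral_smul_weightedDeriv_apply hI, norm_smul, norm_pow, norm_norm,
      ← iteratedFDeriv_integral hI] at this

theorem weightedDeriv_schwartzIntegral (hI : SchwartzIntegrable μ H F) (k n : ℕ) :
    weightedDeriv k n (schwartzIntegral hI) = ∫ z, H z • weightedDeriv k n (F z) ∂μ := by
  refine Subtype.ext (funext fun t ↦ ?_)
  rw [integral_smul_weightedDeriv_apply hI, ← iteratedFDeriv_integral hI]
  rfl

theorem seminorm_schwartzIntegral_le (hI : SchwartzIntegrable μ H F) (k n : ℕ) :
    SchwartzMap.seminorm ℂ k n (schwartzIntegral hI) ≤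
      ∫ z, ‖H z‖ * SchwartzMap.seminorm ℂ k n (F z) ∂μ := by
  rw [← norm_weightedDeriv, weightedDeriv_schwartzIntegral]
  refine (norm_integral_le_integral_norm _).trans_eq ?_
  simp only [norm_smul, norm_weightedDeriv]

theorem exists_norm_apply_le_norm_weightedDeriv (u : 𝓢'(E, ℂ)) :
    ∃ (k n : ℕ) (C : ℝ), ∀ f, ‖u f‖ ≤
      C * ‖fun i : Finset.Iic (k, n) ↦ weightedDeriv (E := E) i.1.1 i.1.2 f‖ := by
  obtain ⟨k, n, C, hC⟩ := exists_le_sup_seminorm ((normSeminorm ℂ ℂ).comp u.toLinearMap)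
    (continuous_norm.comp u.continuous)
  refine ⟨k, n, C, fun f ↦ (hC f).trans (mul_le_mul_of_nonneg_left ?_ C.2)⟩
  refine Seminorm.finset_sup_apply_le (norm_nonneg _) fun i hi ↦ ?_
  exact (norm_weightedDeriv i.1 i.2 f).symm.trans_le (norm_le_pi_norm
    (fun i : Finset.Iic (k, n) ↦ weightedDeriv i.1.1 i.1.2 f) ⟨i, hi⟩)

/-- The functional is continuous for finitely many Schwartz seminorms, so that it factors through
the Banach space of the corresponding weighted derivatives. -/
theorem apply_schwartzIntegral (hI : SchwartzIntegrable μ H F)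
    (u : 𝓢'(E, ℂ)) : u (schwartzIntegral hI) = ∫ z, H z * u (F z) ∂μ := by
  obtain ⟨k, n, C, hC⟩ := exists_norm_apply_le_norm_weightedDeriv u
  let J : 𝓢(E, ℂ) →L[ℂ] (∀ i : Finset.Iic (k, n), lp (fun _ : E ↦ E [×i.1.2]→L[ℝ] ℂ) ∞) :=
    ContinuousLinearMap.pi fun i ↦ weightedDeriv i.1.1 i.1.2
  obtain ⟨L, hL⟩ := exists_continuous_factor J.toLinearMap u.toLinearMap C hC
  have hLu (f : 𝓢(E, ℂ)) : L (J f) = u f := hL f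
  have hJ : Integrable (fun z ↦ H z • J (F z)) μ :=
    Integrable.of_eval fun i ↦ integrable_smul_weightedDeriv hI i.1.1 i.1.2
  have hJG : J (schwartzIntegral hI) = ∫ z, H z • J (F z) ∂μ := by
    refine funext fun i ↦ (weightedDeriv_schwartzIntegral hI i.1.1 i.1.2).trans ?_
    exact (ContinuousLinearMap.proj (R := ℂ)
      (φ := fun i : Finset.Iic (k, n) ↦ lp (fun _ : E ↦ E [×i.1.2]→L[ℝ] ℂ) ∞)
      i).integral_comp_comm hJ
  rw [← hLu, hJG, ← L.integral_comp_comm hJ]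
  simp only [map_smul, hLu, smul_eq_mul]

end SchwartzIntegral

/-! ### Rapid decay and polynomial growth -/

section Decay

variable {X Y F A : Type*} [NormedAddCommGroup X] [NormedAddCommGroup Y] [NormedAddCommGroup F]
  [SeminormedRing A]

/-- Decay of `f` at infinity faster than any power of the norm. No regularity is included. -/
def RapidDecay (f : X → F) : Prop := ∀ N : ℕ, ∃ C : ℝ, ∀ z, (1 + ‖z‖) ^ N * ‖f z‖ ≤ C

/-- Growth of `f` at infinity at most like some power of the norm. -/
def PolyGrowth {F : Type*} [SeminormedAddCommGroup F] (f : X → F) : Prop :=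
  ∃ (m : ℕ) (C : ℝ), 0 ≤ C ∧ ∀ z, ‖f z‖ ≤ C * (1 + ‖z‖) ^ m

theorem polyGrowth_norm_iff {f : X → F} : PolyGrowth (fun z ↦ ‖f z‖) ↔ PolyGrowth f := by
  simp only [PolyGrowth, norm_norm]

theorem PolyGrowth.mul {f g : X → A} (hf : PolyGrowth f) (hg : PolyGrowth g) :
    PolyGrowth fun z ↦ f z * g z := by
  obtain ⟨m, C, hC, hf⟩ := hf
  obtain ⟨l, D, hD, hg⟩ := hg
  refine ⟨m + l, C * D, mul_nonneg hC hD, fun z ↦ ?_⟩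
  calc ‖f z * g z‖ ≤ ‖f z‖ * ‖g z‖ := norm_mul_le _ _
    _ ≤ C * (1 + ‖z‖) ^ m * (D * (1 + ‖z‖) ^ l) := by gcongr; exacts [hf z, hg z]
    _ = C * D * (1 + ‖z‖) ^ (m + l) := by ring

theorem PolyGrowth.comp {f : X → F} {g : Y → X} (hf : PolyGrowth f) (hg : PolyGrowth g) :
    PolyGrowth fun y ↦ f (g y) := by
  obtain ⟨m, C, hC, hf⟩ := hf
  obtain ⟨l, D, hD, hg⟩ := hg
  refine ⟨l * m, C * (1 + D) ^ m, by positivity, fun y ↦ (hf _).trans ?_⟩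
  have h1 : 1 ≤ (1 + ‖y‖) ^ l := one_le_pow₀ (le_add_of_nonneg_right (norm_nonneg y))
  calc C * (1 + ‖g y‖) ^ m ≤ C * ((1 + D) * (1 + ‖y‖) ^ l) ^ m := by
        gcongr
        linarith [hg y]
    _ = C * (1 + D) ^ m * (1 + ‖y‖) ^ (l * m) := by rw [mul_pow, pow_mul, mul_assoc]

theorem PolyGrowth.of_norm_le_norm {f : X → F} (h : ∀ z, ‖f z‖ ≤ ‖z‖) : PolyGrowth f :=
  ⟨1, 1, zero_le_one, fun z ↦ by linarith [h z]⟩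

theorem RapidDecay.mul_polyGrowth {A : Type*} [NormedRing A] {f g : X → A} (hf : RapidDecay f)
    (hg : PolyGrowth g) : RapidDecay fun z ↦ f z * g z := by
  intro N
  obtain ⟨m, C, hC, hg⟩ := hg
  obtain ⟨B, hf⟩ := hf (N + m)
  refine ⟨B * C, fun z ↦ ?_⟩
  calc (1 + ‖z‖) ^ N * ‖f z * g z‖ ≤ (1 + ‖z‖) ^ N * (‖f z‖ * (C * (1 + ‖z‖) ^ m)) := by
        gcongr
        exact (norm_mul_le _ _).trans (mul_le_mul_of_nonneg_left (hg z) (norm_nonneg _))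
    _ = (1 + ‖z‖) ^ (N + m) * ‖f z‖ * C := by ring
    _ ≤ B * C := mul_le_mul_of_nonneg_right (hf z) hC

theorem PolyGrowth.rapidDecay_indicator {f : X → F} (hf : PolyGrowth f) (r : ℝ) :
    RapidDecay ((Metric.closedBall 0 r).indicator f) := by
  intro N
  obtain ⟨m, C, hC, hf⟩ := hf
  refine ⟨(1 + |r|) ^ N * (C * (1 + |r|) ^ m), fun z ↦ ?_⟩
  by_cases hz : z ∈ Metric.closedBall 0 r
  · have hzr : ‖z‖ ≤ |r| := (mem_closedBall_zero_iff.1 hz).trans (le_abs_self r)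
    rw [Set.indicator_of_mem hz]
    gcongr
    exact (hf z).trans (by gcongr)
  · rw [Set.indicator_of_notMem hz, norm_zero, mul_zero]
    positivity

theorem one_add_norm_le_mul (z w : X) : 1 + ‖z‖ ≤ (1 + ‖w‖) * (1 + ‖z - w‖) := by
  have : ‖z‖ ≤ ‖z - w‖ + ‖w‖ := by simpa only [sub_add_cancel] using norm_add_le (z - w) w
  nlinarith [mul_nonneg (norm_nonneg w) (norm_nonneg (z - w))]

variable [NormedSpace ℝ X] [FiniteDimensional ℝ X] [MeasurableSpace X] [BorelSpace X]
  (μ : Measure X) [μ.IsAddHaarMeasure]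

theorem integrable_inv_one_add_norm_pow {D : ℕ} (hD : Module.finrank ℝ X < D) :
    Integrable (fun z : X ↦ ((1 + ‖z‖) ^ D)⁻¹) μ := by
  refine (integrable_one_add_norm (μ := μ) (r := D) (mod_cast hD)).congr (ae_of_all _ fun z ↦ ?_)
  simp only [Real.rpow_neg (by positivity : 0 ≤ 1 + ‖z‖), Real.rpow_natCast]

theorem exists_integral_norm_le : ∃ (D : ℕ) (A : ℝ), 0 ≤ A ∧ ∀ (f : X → F) (C : ℝ),
    (∀ z, (1 + ‖z‖) ^ D * ‖f z‖ ≤ C) → ∫ z, ‖f z‖ ∂μ ≤ A * C := by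
  refine ⟨Module.finrank ℝ X + 1, ∫ z, ((1 + ‖z‖) ^ (Module.finrank ℝ X + 1))⁻¹ ∂μ,
    integral_nonneg fun z ↦ by positivity, fun f C hf ↦ ?_⟩
  rw [← integral_mul_const]
  refine integral_mono_of_nonneg (ae_of_all _ fun z ↦ norm_nonneg _)
    ((integrable_inv_one_add_norm_pow μ (Nat.lt_succ_self _)).mul_const C) (ae_of_all _ fun z ↦ ?_)
  exact (le_inv_mul_iff₀ (by positivity)).2 (hf z)

theorem RapidDecay.integrable {f : X → F} (hf : RapidDecay f) (hm : AEStronglyMeasurable f μ) :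
    Integrable f μ := by
  obtain ⟨C, hC⟩ := hf (Module.finrank ℝ X + 1)
  refine ((integrable_inv_one_add_norm_pow μ (Nat.lt_succ_self _)).mul_const C).mono' hm
    (ae_of_all _ fun z ↦ ?_)
  exact (le_inv_mul_iff₀ (by positivity)).2 (hC z)

end Decay

/-! ### Gabor coefficients and the reproducing formula -/

section GaborCoefficients

variable {V : Type*} [NormedAddCommGroup V]

theorem norm_mk_neg (z : V × V) : ‖(z.1, -z.2)‖ = ‖z‖ := by
  rw [Prod.norm_mk, norm_neg, Prod.norm_def]

theorem continuous_mk_neg : Continuous fun z : V × V ↦ (z.1, -z.2) := by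
  fun_prop

variable [InnerProductSpace ℝ V]

theorem conjugate_conjugate (f : 𝓢(V, ℂ)) : conjugate (conjugate f) = f := by
  ext t
  rw [conjugate_apply, conjugate_apply, Complex.conj_conj]

theorem conjugate_atom (z : V × V) (φ : 𝓢(V, ℂ)) :
    conjugate (atom z φ) = atom (z.1, -z.2) (conjugate φ) := by
  ext t
  simp only [conjugate_apply, atom_apply, map_mul, ← Complex.exp_conj, Complex.conj_ofReal,
    Complex.conj_I, inner_neg_right, Complex.ofReal_neg, mul_neg, neg_mul]

/-- The short-time Fourier transform `(u, M_ξ T_x φ)` at `z = (x, ξ)`, without the normalizing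
factor `(2π)^{-n/2}`, which is immaterial for growth and decay. -/
def gaborCoeff (φ : 𝓢(V, ℂ)) (u : 𝓢'(V, ℂ)) (z : V × V) : ℂ := action u (atom z φ)

theorem gaborCoeff_conjugate (φ : 𝓢(V, ℂ)) (u : 𝓢'(V, ℂ)) (z : V × V) :
    gaborCoeff (conjugate φ) u (z.1, -z.2) = u (atom z φ) := by
  rw [gaborCoeff, action, conjugate_atom, conjugate_conjugate, neg_neg]

/-- The localization of `f` near `x` by the translated window, whose Fourier transform is, up to a
scaling, the Gabor coefficient as a function of the frequency. -/
def mulTranslate (φ f : 𝓢(V, ℂ)) (x : V) : 𝓢(V, ℂ) :=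
  SchwartzMap.smulLeftCLM ℂ (translation x φ) f

theorem mulTranslate_apply (φ f : 𝓢(V, ℂ)) (x t : V) :
    mulTranslate φ f x t = φ (t - x) * f t := by
  rw [mulTranslate, SchwartzMap.smulLeftCLM_apply_apply (SchwartzMap.hasTemperateGrowth _),
    translation_apply, smul_eq_mul]

variable [FiniteDimensional ℝ V]

theorem exists_ne_zero : ∃ φ : 𝓢(V, ℂ), φ ≠ 0 := by
  let b : ContDiffBump (0 : V) := ⟨1, 2, one_pos, one_lt_two⟩
  have hs : HasCompactSupport fun t : V ↦ ((b t : ℝ) : ℂ) :=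
    b.hasCompactSupport.comp_left (g := fun r : ℝ ↦ (r : ℂ)) Complex.ofReal_zero
  refine ⟨hs.toSchwartzMap (Complex.ofRealCLM.contDiff.comp b.contDiff), fun h ↦ ?_⟩
  have h0 : ((b 0 : ℝ) : ℂ) = 0 := congrArg (fun f : 𝓢(V, ℂ) ↦ f 0) h
  rw [b.one_of_mem_closedBall (Metric.mem_closedBall_self zero_le_one)] at h0
  exact one_ne_zero h0

variable [MeasurableSpace V] [BorelSpace V]

theorem polyGrowth_seminorm_atom (p : Seminorm ℂ 𝓢(V, ℂ)) (hp : Continuous p) (φ : 𝓢(V, ℂ)) :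
    PolyGrowth fun z ↦ p (atom z φ) := by
  obtain ⟨q, m, -, h⟩ := exists_seminorm_atom_le p hp
  refine ⟨m, q φ, apply_nonneg q φ, fun z ↦ ?_⟩
  rw [Real.norm_of_nonneg (apply_nonneg p _), mul_comm]
  exact h z φ

theorem continuous_conjugate_atom (φ : 𝓢(V, ℂ)) : Continuous fun z ↦ conjugate (atom z φ) := by
  simp_rw [conjugate_atom]
  exact (continuous_atom (conjugate φ)).comp continuous_mk_neg

theorem polyGrowth_seminorm_conjugate_atom (p : Seminorm ℂ 𝓢(V, ℂ)) (hp : Continuous p)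
    (φ : 𝓢(V, ℂ)) : PolyGrowth fun z ↦ p (conjugate (atom z φ)) := by
  simp_rw [conjugate_atom]
  exact (polyGrowth_seminorm_atom p hp (conjugate φ)).comp
    (.of_norm_le_norm fun z ↦ (norm_mk_neg z).le)

theorem continuous_apply_atom (φ : 𝓢(V, ℂ)) (u : 𝓢'(V, ℂ)) : Continuous fun z ↦ u (atom z φ) :=
  u.continuous.comp (continuous_atom φ)

theorem polyGrowth_apply_atom (φ : 𝓢(V, ℂ)) (u : 𝓢'(V, ℂ)) :
    PolyGrowth fun z ↦ u (atom z φ) :=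
  polyGrowth_norm_iff.1 <| polyGrowth_seminorm_atom ((normSeminorm ℂ ℂ).comp u.toLinearMap)
    (continuous_norm.comp u.continuous) φ

theorem continuous_gaborCoeff (φ : 𝓢(V, ℂ)) (u : 𝓢'(V, ℂ)) : Continuous (gaborCoeff φ u) :=
  u.continuous.comp (continuous_conjugate_atom φ)

theorem polyGrowth_gaborCoeff (φ : 𝓢(V, ℂ)) (u : 𝓢'(V, ℂ)) : PolyGrowth (gaborCoeff φ u) :=
  polyGrowth_norm_iff.1 <| polyGrowth_seminorm_conjugate_atom
    ((normSeminorm ℂ ℂ).comp u.toLinearMap) (continuous_norm.comp u.continuous) φ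

instance isAddHaarMeasure_volume_prod : (volume : Measure (V × V)).IsAddHaarMeasure :=
  Measure.prod.instIsAddHaarMeasure _ _

theorem RapidDecay.schwartzIntegrable {H : V × V → ℂ} {F : V × V → 𝓢(V, ℂ)} (hH : RapidDecay H)
    (hm : AEStronglyMeasurable H) (hF : Continuous F)
    (hgrowth : ∀ k n, PolyGrowth fun z ↦ SchwartzMap.seminorm ℂ k n (F z)) :
    SchwartzIntegrable volume H F where
  aestronglyMeasurable := hm
  continuous := hF
  integrable k n := by
    have hnorm : RapidDecay fun z ↦ ‖H z‖ := fun N ↦ by simpa only [norm_norm] using hH N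
    refine (hnorm.mul_polyGrowth (hgrowth k n)).integrable (X := V × V) _ (hm.norm.mul ?_)
    exact (((schwartz_withSeminorms ℂ V ℂ).continuous_seminorm (k, n)).comp
      hF).aestronglyMeasurable

/-- The coefficient `∫ f · M_ξ T_x φ`, where `z = (x, ξ)`. -/
def windowCoeff (φ f : 𝓢(V, ℂ)) (z : V × V) : ℂ := ∫ t, f t * atom z φ t

theorem toTemperedDistributionCLM_atom (φ f : 𝓢(V, ℂ)) (z : V × V) :
    SchwartzMap.toTemperedDistributionCLM V ℂ volume f (atom z φ) = windowCoeff φ f z := by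
  refine (SchwartzMap.toTemperedDistributionCLM_apply_apply volume f (atom z φ)).trans ?_
  simp_rw [windowCoeff, smul_eq_mul, mul_comm]

theorem continuous_windowCoeff (φ f : 𝓢(V, ℂ)) : Continuous (windowCoeff φ f) := by
  simp_rw [← funext (toTemperedDistributionCLM_atom φ f)]
  exact continuous_apply_atom φ _

theorem exists_seminorm_integral_norm_mul_sub_le (φ : 𝓢(V, ℂ)) (N : ℕ) :
    ∃ q : Seminorm ℂ 𝓢(V, ℂ), Continuous q ∧
      ∀ f x, (1 + ‖x‖) ^ N * ∫ t, ‖f t‖ * ‖φ (t - x)‖ ≤ q f := by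
  obtain ⟨D, A, hA, hint⟩ := exists_integral_norm_le (F := ℝ) (volume : Measure V)
  have hdecay (m : ℕ) (f : 𝓢(V, ℂ)) (t : V) : (1 + ‖t‖) ^ m * ‖f t‖ ≤
      2 ^ m * (Finset.Iic (m, 0)).sup (schwartzSeminormFamily ℂ V ℂ) f := by
    rw [← norm_iteratedFDeriv_zero (𝕜 := ℝ) (f := f)]
    exact SchwartzMap.one_add_le_sup_seminorm_apply (m := (m, 0)) le_rfl le_rfl f t
  set r := (Finset.Iic (D + N, 0)).sup (schwartzSeminormFamily ℂ V ℂ)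
  set B := 2 ^ N * (Finset.Iic (N, 0)).sup (schwartzSeminormFamily ℂ V ℂ) φ
  have hB : 0 ≤ B := by positivity
  lift A to NNReal using hA
  lift B to NNReal using hB with b hb
  refine ⟨(A * (2 ^ (D + N) * b)) • r, (continuous_sup_seminorm _).const_smul
    (A * (2 ^ (D + N) * b)), fun f x ↦ ?_⟩
  have hx (t : V) : 1 + ‖x‖ ≤ (1 + ‖t‖) * (1 + ‖t - x‖) := by
    simpa only [norm_sub_rev] using one_add_norm_le_mul x t
  have hpt (t : V) : (1 + ‖t‖) ^ D * ‖(1 + ‖x‖) ^ N * (‖f t‖ * ‖φ (t - x)‖)‖ ≤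
      2 ^ (D + N) * r f * b := by
    rw [Real.norm_of_nonneg (by positivity)]
    calc (1 + ‖t‖) ^ D * ((1 + ‖x‖) ^ N * (‖f t‖ * ‖φ (t - x)‖))
        ≤ (1 + ‖t‖) ^ D * (((1 + ‖t‖) * (1 + ‖t - x‖)) ^ N * (‖f t‖ * ‖φ (t - x)‖)) := by
          gcongr
          exact hx t
      _ = ((1 + ‖t‖) ^ (D + N) * ‖f t‖) * ((1 + ‖t - x‖) ^ N * ‖φ (t - x)‖) := by
          rw [mul_pow]
          ring
      _ ≤ 2 ^ (D + N) * r f * b :=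
          mul_le_mul (hdecay _ f t) ((hdecay N φ _).trans_eq hb.symm) (by positivity)
            (by positivity)
  calc (1 + ‖x‖) ^ N * ∫ t, ‖f t‖ * ‖φ (t - x)‖
      = ∫ t, ‖(1 + ‖x‖) ^ N * (‖f t‖ * ‖φ (t - x)‖)‖ := by
        rw [← integral_const_mul]
        congr with t
        exact (Real.norm_of_nonneg (by positivity)).symm
    _ ≤ A * (2 ^ (D + N) * r f * b) := hint _ _ hpt
    _ = (A * (2 ^ (D + N) * b)) * r f := by ring

theorem norm_fourier_translation (x : V) (φ : 𝓢(V, ℂ)) (η : V) :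
    ‖𝓕 (translation x φ) η‖ = ‖𝓕 φ η‖ := by
  have h : 𝓕 (translation x φ) η = Real.fourierChar (inner ℝ (-x) η) • 𝓕 φ η := by
    rw [SchwartzMap.fourier_coe, SchwartzMap.fourier_coe]
    refine Eq.trans ?_ (congrFun (VectorFourier.fourierIntegral_comp_add_right
      Real.fourierChar volume (innerₗ V) φ (-x)) η)
    simp only [← sub_eq_add_neg]
    rfl
  rw [h, Circle.norm_smul]

theorem norm_windowCoeff_le (φ f : 𝓢(V, ℂ)) (z : V × V) :
    ‖windowCoeff φ f z‖ ≤ ∫ t, ‖f t‖ * ‖φ (t - z.1)‖ := by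
  refine (norm_integral_le_integral_norm _).trans_eq ?_
  simp_rw [norm_mul, norm_atom_apply]

/-- The Fourier transform exchanges translations and modulations. -/
theorem norm_windowCoeff_le_fourier (φ f : 𝓢(V, ℂ)) (z : V × V) :
    ‖windowCoeff φ f z‖ ≤ ∫ t, ‖𝓕⁻ f t‖ * ‖𝓕 φ (t - (2 * Real.pi)⁻¹ • z.2)‖ := by
  rw [windowCoeff, atom, modulation_eq_fourierInv, ← SchwartzMap.integral_fourierInv_mul_eq]
  refine (norm_integral_le_integral_norm _).trans_eq ?_
  simp_rw [norm_mul, translation_apply, norm_fourier_translation]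

theorem exists_seminorm_windowCoeff_le (φ : 𝓢(V, ℂ)) (N : ℕ) :
    ∃ q : Seminorm ℂ 𝓢(V, ℂ), Continuous q ∧
      ∀ f z, (1 + ‖z‖) ^ N * ‖windowCoeff φ f z‖ ≤ q f := by
  let 𝓕₂ : 𝓢(V, ℂ) →L[ℂ] 𝓢(V, ℂ) := FourierTransform.fourierInvCLM ℂ 𝓢(V, ℂ)
  obtain ⟨q, hq, hx⟩ := exists_seminorm_integral_norm_mul_sub_le φ N
  obtain ⟨r, hr, hξ⟩ := exists_seminorm_integral_norm_mul_sub_le (𝓕 φ) N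
  let c : NNReal := ⟨(2 * Real.pi) ^ N, by positivity⟩
  refine ⟨q + c • r.comp 𝓕₂.toLinearMap, hq.add ((hr.comp 𝓕₂.continuous).const_smul c),
    fun f z ↦ ?_⟩
  have hfst : (1 + ‖z.1‖) ^ N * ‖windowCoeff φ f z‖ ≤ q f :=
    (mul_le_mul_of_nonneg_left (norm_windowCoeff_le φ f z) (by positivity)).trans (hx f z.1)
  have hscale : 1 + ‖z.2‖ ≤ 2 * Real.pi * (1 + ‖(2 * Real.pi)⁻¹ • z.2‖) := by
    rw [norm_smul, norm_inv, Real.norm_of_nonneg (by positivity), mul_add,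
      mul_inv_cancel_left₀ (by positivity)]
    linarith [Real.pi_gt_three]
  have hsnd : (1 + ‖z.2‖) ^ N * ‖windowCoeff φ f z‖ ≤ c * r (𝓕₂ f) := by
    calc (1 + ‖z.2‖) ^ N * ‖windowCoeff φ f z‖
        ≤ (2 * Real.pi * (1 + ‖(2 * Real.pi)⁻¹ • z.2‖)) ^ N *
          ∫ t, ‖𝓕⁻ f t‖ * ‖𝓕 φ (t - (2 * Real.pi)⁻¹ • z.2)‖ := by
          gcongr
          exact norm_windowCoeff_le_fourier φ f z
      _ = (2 * Real.pi) ^ N * ((1 + ‖(2 * Real.pi)⁻¹ • z.2‖) ^ N *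
          ∫ t, ‖𝓕⁻ f t‖ * ‖𝓕 φ (t - (2 * Real.pi)⁻¹ • z.2)‖) := by rw [mul_pow, mul_assoc]
      _ ≤ c * r (𝓕₂ f) := mul_le_mul_of_nonneg_left (hξ _ _) (by positivity)
  change (1 + max ‖z.1‖ ‖z.2‖) ^ N * _ ≤ q f + c * r (𝓕₂ f)
  have hq0 := apply_nonneg q f
  have hr0 : 0 ≤ c * r (𝓕₂ f) := by positivity
  rcases max_choice ‖z.1‖ ‖z.2‖ with h | h <;> rw [h] <;> linarith

theorem rapidDecay_windowCoeff (φ f : 𝓢(V, ℂ)) : RapidDecay (windowCoeff φ f) := fun N ↦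
  let ⟨q, _, h⟩ := exists_seminorm_windowCoeff_le φ N
  ⟨q f, h f⟩

theorem norm_windowCoeff_conjugate_atom (φ ψ : 𝓢(V, ℂ)) (z w : V × V) :
    ‖windowCoeff φ (conjugate (atom w ψ)) z‖ = ‖windowCoeff φ (conjugate ψ) (z - w)‖ := by
  have h : windowCoeff φ (conjugate (atom w ψ)) z =
      Complex.exp (((inner ℝ w.1 (z.2 - w.2) : ℝ) : ℂ) * Complex.I) *
        windowCoeff φ (conjugate ψ) (z - w) := by
    rw [windowCoeff, windowCoeff, ← integral_add_right_eq_self _ w.1, ← integral_const_mul]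
    congr with t
    have hphase : Complex.exp (((inner ℝ (t + w.1) (-w.2) : ℝ) : ℂ) * Complex.I) *
        Complex.exp (((inner ℝ (t + w.1) z.2 : ℝ) : ℂ) * Complex.I) =
        Complex.exp (((inner ℝ w.1 (z.2 - w.2) : ℝ) : ℂ) * Complex.I) *
        Complex.exp (((inner ℝ t (z.2 - w.2) : ℝ) : ℂ) * Complex.I) := by
      simp only [← Complex.exp_add, inner_add_left, inner_sub_right, inner_neg_right,
        Complex.ofReal_add, Complex.ofReal_sub, Complex.ofReal_neg]
      ring_nf
    simp only [conjugate_atom, atom_apply, conjugate_apply, Prod.fst_sub, Prod.snd_sub]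
    rw [add_sub_cancel_right, show t - (z.1 - w.1) = t + w.1 - z.1 by abel]
    linear_combination ((starRingEnd ℂ) (ψ t) * φ (t + w.1 - z.1)) * hphase
  rw [h, norm_mul, Complex.norm_exp_ofReal_mul_I, one_mul]

theorem windowCoeff_eq_fourier (φ f : 𝓢(V, ℂ)) (x ξ : V) :
    windowCoeff φ f (x, ξ) = 𝓕 (mulTranslate φ f x) ((-(2 * Real.pi)⁻¹) • ξ) := by
  rw [SchwartzMap.fourier_coe, Real.fourier_eq', windowCoeff]
  congr with t
  have hξ : -2 * Real.pi * (-(2 * Real.pi)⁻¹ * inner ℝ t ξ) = inner ℝ t ξ := by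
    field_simp
  rw [atom_apply, mulTranslate_apply, inner_smul_right, smul_eq_mul, hξ]
  ring

theorem integral_windowCoeff_mul_frequency (φ f : 𝓢(V, ℂ)) (x t : V) :
    ∫ ξ, windowCoeff φ f (x, ξ) * conjugate (atom (x, ξ) φ) t =
      ((2 * Real.pi) ^ Module.finrank ℝ V : ℝ) * (f t * (‖φ (t - x)‖ ^ 2 : ℝ)) := by
  set h := mulTranslate φ f x
  let I (w : V) : ℂ := Complex.exp (((2 * Real.pi * inner ℝ w t : ℝ) : ℂ) * Complex.I) • 𝓕 h w
  have hinv : ∫ w, I w = h t := by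
    rw [← Real.fourierInv_eq' (𝓕 h : 𝓢(V, ℂ)) t, ← SchwartzMap.fourierInv_coe,
      FourierTransform.fourierInv_fourier_eq]
  have hscale : ∫ ξ, I (-(2 * Real.pi)⁻¹ • ξ) = ((2 * Real.pi) ^ Module.finrank ℝ V : ℝ) * h t := by
    rw [Measure.integral_comp_smul, hinv, abs_inv, abs_pow, abs_neg, abs_inv,
      abs_of_pos (by positivity), inv_pow, inv_inv, Complex.real_smul]
  have hintegrand (ξ : V) : windowCoeff φ f (x, ξ) * conjugate (atom (x, ξ) φ) t =
      (starRingEnd ℂ) (φ (t - x)) * I (-(2 * Real.pi)⁻¹ • ξ) := by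
    have hξ : 2 * Real.pi * inner ℝ (-(2 * Real.pi)⁻¹ • ξ) t = inner ℝ t (-ξ) := by
      rw [real_inner_smul_left, inner_neg_right, real_inner_comm]
      field_simp
    simp only [I]
    rw [windowCoeff_eq_fourier, conjugate_atom, atom_apply, conjugate_apply, hξ, smul_eq_mul]
    ring
  simp_rw [hintegrand]
  rw [integral_const_mul, hscale, mulTranslate_apply, ← Complex.normSq_eq_norm_sq,
    Complex.normSq_eq_conj_mul_self]
  ring

theorem schwartzIntegrable_windowCoeff_conjugate_atom (φ f : 𝓢(V, ℂ)) :
    SchwartzIntegrable volume (windowCoeff φ f) fun z ↦ conjugate (atom z φ) :=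
  (rapidDecay_windowCoeff φ f).schwartzIntegrable
    (continuous_windowCoeff φ f).aestronglyMeasurable (continuous_conjugate_atom φ) fun k n ↦
      polyGrowth_seminorm_conjugate_atom _
        ((schwartz_withSeminorms ℂ V ℂ).continuous_seminorm (k, n)) φ

theorem integral_windowCoeff_mul (φ f : 𝓢(V, ℂ)) (t : V) :
    ∫ z, windowCoeff φ f z * conjugate (atom z φ) t =
      ((2 * Real.pi) ^ Module.finrank ℝ V * ∫ x, ‖φ x‖ ^ 2 : ℝ) * f t := by
  have hint := (schwartzIntegrable_windowCoeff_conjugate_atom φ f).integrable_mul_apply t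
  rw [Measure.volume_eq_prod] at hint ⊢
  rw [integral_prod _ hint]
  simp_rw [integral_windowCoeff_mul_frequency]
  rw [integral_const_mul, integral_const_mul, integral_complex_ofReal,
    integral_sub_left_eq_self (fun x ↦ ‖φ x‖ ^ 2) volume t, Complex.ofReal_mul]
  ring

theorem integral_norm_sq_pos {φ : 𝓢(V, ℂ)} (hφ : φ ≠ 0) : 0 < ∫ x, ‖φ x‖ ^ 2 := by
  have hint : Integrable fun x ↦ ‖φ x‖ ^ 2 :=
    (memLp_two_iff_integrable_sq_norm φ.continuous.aestronglyMeasurable).1 (φ.memLp 2 volume)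
  obtain ⟨x, hx⟩ := DFunLike.ne_iff.1 hφ
  rw [integral_pos_iff_support_of_nonneg (fun x ↦ by positivity) hint]
  exact (φ.continuous.norm.pow 2).isOpen_support.measure_pos volume
    ⟨x, pow_ne_zero 2 (norm_ne_zero_iff.2 hx)⟩

/-- The normalizing constant in the inversion formula. -/
def windowConst (φ : 𝓢(V, ℂ)) : ℂ :=
  (((2 * Real.pi) ^ Module.finrank ℝ V * ∫ x, ‖φ x‖ ^ 2 : ℝ) : ℂ)⁻¹

theorem apply_eq_integral_windowCoeff {φ : 𝓢(V, ℂ)} (hφ : φ ≠ 0) (u : 𝓢'(V, ℂ)) (f : 𝓢(V, ℂ)) :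
    u f = windowConst φ * ∫ z, windowCoeff φ f z * gaborCoeff φ u z := by
  have hI := schwartzIntegrable_windowCoeff_conjugate_atom φ f
  have hf : f = windowConst φ • schwartzIntegral hI := by
    ext t
    have hne : ((2 * Real.pi) ^ Module.finrank ℝ V * ∫ x, ‖φ x‖ ^ 2 : ℝ) ≠ 0 :=
      (mul_pos (by positivity) (integral_norm_sq_pos hφ)).ne'
    refine (inv_mul_cancel_left₀ (Complex.ofReal_ne_zero.2 hne) (f t)).symm.trans ?_
    rw [← integral_windowCoeff_mul φ f t]
    rfl
  conv_lhs => rw [hf, map_smul, apply_schwartzIntegral, smul_eq_mul]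
  rfl

theorem norm_gaborCoeff_le {φ : 𝓢(V, ℂ)} (hφ : φ ≠ 0) (ψ : 𝓢(V, ℂ)) (u : 𝓢'(V, ℂ)) (w : V × V) :
    ‖gaborCoeff ψ u w‖ ≤ ‖windowConst φ‖ *
      ∫ z, ‖windowCoeff φ (conjugate ψ) (z - w)‖ * ‖gaborCoeff φ u z‖ := by
  rw [gaborCoeff, action, apply_eq_integral_windowCoeff hφ u, norm_mul]
  gcongr
  refine (norm_integral_le_integral_norm _).trans_eq ?_
  simp_rw [norm_mul, norm_windowCoeff_conjugate_atom]

theorem toTemperedDistributionCLM_comm (f g : 𝓢(V, ℂ)) :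
    SchwartzMap.toTemperedDistributionCLM V ℂ volume f g =
      SchwartzMap.toTemperedDistributionCLM V ℂ volume g f := by
  refine (SchwartzMap.toTemperedDistributionCLM_apply_apply volume f g).trans
    (Eq.trans ?_ (SchwartzMap.toTemperedDistributionCLM_apply_apply volume g f).symm)
  simp_rw [smul_eq_mul, mul_comm]

/-- The approximations are obtained by truncating the integral in the inversion formula. -/
theorem exists_seq_tendsto_toTemperedDistributionCLM (u : 𝓢'(V, ℂ)) : ∃ f : ℕ → 𝓢(V, ℂ),
    Tendsto (fun n ↦ SchwartzMap.toTemperedDistributionCLM V ℂ volume (f n)) atTop (𝓝 u) := by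
  obtain ⟨φ, hφ⟩ := exists_ne_zero (V := V)
  let H (n : ℕ) : V × V → ℂ := (Metric.closedBall 0 n).indicator (gaborCoeff φ u)
  have hm (n : ℕ) : AEStronglyMeasurable (H n) :=
    (continuous_gaborCoeff φ u).aestronglyMeasurable.indicator
      Metric.isClosed_closedBall.measurableSet
  have hI (n : ℕ) : SchwartzIntegrable volume (H n) fun z ↦ atom z φ :=
    ((polyGrowth_gaborCoeff φ u).rapidDecay_indicator n).schwartzIntegrable (hm n)
      (continuous_atom φ) fun k m ↦ polyGrowth_seminorm_atom _
        ((schwartz_withSeminorms ℂ V ℂ).continuous_seminorm (k, m)) φ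
  refine ⟨fun n ↦ windowConst φ • schwartzIntegral (hI n),
    PointwiseConvergenceCLM.tendsto_iff_forall_tendsto.2 fun g ↦ ?_⟩
  have happrox (n : ℕ) : SchwartzMap.toTemperedDistributionCLM V ℂ volume
      (windowConst φ • schwartzIntegral (hI n)) g =
        windowConst φ * ∫ z, H n z * windowCoeff φ g z := by
    rw [toTemperedDistributionCLM_comm, map_smul, apply_schwartzIntegral, smul_eq_mul]
    simp_rw [toTemperedDistributionCLM_atom]
  simp_rw [happrox]
  rw [apply_eq_integral_windowCoeff hφ u g]
  have hint : Integrable fun z ↦ windowCoeff φ g z * gaborCoeff φ u z :=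
    ((rapidDecay_windowCoeff φ g).mul_polyGrowth (polyGrowth_gaborCoeff φ u)).integrable volume
      ((continuous_windowCoeff φ g).mul (continuous_gaborCoeff φ u)).aestronglyMeasurable
  refine (tendsto_integral_of_dominated_convergence _
    (fun n ↦ (hm n).mul (continuous_windowCoeff φ g).aestronglyMeasurable) hint.norm
    (fun n ↦ ae_of_all _ fun z ↦ ?_) (ae_of_all _ fun z ↦ ?_)).const_mul _
  · rw [Pi.mul_apply, norm_mul, norm_mul, mul_comm]
    gcongr
    exact norm_indicator_le_norm_self _ _
  · refine tendsto_const_nhds.congr' ?_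
    filter_upwards [eventually_ge_atTop ⌈‖z‖⌉₊] with n hn
    have hz : z ∈ Metric.closedBall 0 (n : ℝ) := mem_closedBall_zero_iff.2 (Nat.ceil_le.1 hn)
    simp only [H, Pi.mul_apply, Set.indicator_of_mem hz, mul_comm]

end GaborCoefficients

/-! ### Anisotropic dilations -/

/-- The anisotropic dilation `(x, ξ) ↦ (l x, l^s ξ)`. -/
def dilation {V : Type*} [NormedAddCommGroup V] [NormedSpace ℝ V] (s l : ℝ) (z : V × V) : V × V :=
  (l • z.1, l ^ s • z.2)

/-- The gauge `max (|x|, |ξ|^{1/s})` of phase space, homogeneous of degree one for the anisotropic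
dilations. -/
def homNorm {V : Type*} [NormedAddCommGroup V] (s : ℝ) (z : V × V) : ℝ :=
  max ‖z.1‖ (‖z.2‖ ^ s⁻¹)

theorem rpow_le_one_add_pow_ceil {a b : ℝ} (ha : 0 ≤ a) (hab : a ≤ b) {r : ℝ} (hr : 0 ≤ r) :
    a ^ r ≤ (1 + b) ^ (⌈r⌉₊ + 1) := by
  have hb : 1 ≤ 1 + b := by linarith
  calc a ^ r ≤ (1 + b) ^ r := Real.rpow_le_rpow ha (by linarith) hr
    _ ≤ (1 + b) ^ ((⌈r⌉₊ : ℕ) : ℝ) := Real.rpow_le_rpow_of_exponent_le hb (Nat.le_ceil r)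
    _ = (1 + b) ^ ⌈r⌉₊ := Real.rpow_natCast _ _
    _ ≤ (1 + b) ^ (⌈r⌉₊ + 1) := pow_le_pow_right₀ hb (Nat.le_succ _)

section HomNorm

variable {V : Type*} [NormedAddCommGroup V] {s : ℝ}

theorem homNorm_nonneg (s : ℝ) (z : V × V) : 0 ≤ homNorm s z :=
  (norm_nonneg z.1).trans (le_max_left _ _)

theorem homNorm_zero (hs : 0 < s) : homNorm s (0 : V × V) = 0 := by
  rw [homNorm, Prod.fst_zero, Prod.snd_zero, norm_zero, Real.zero_rpow (inv_pos.2 hs).ne', max_self]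

theorem continuous_homNorm (hs : 0 < s) : Continuous fun z : V × V ↦ homNorm s z :=
  continuous_fst.norm.max (continuous_snd.norm.rpow_const fun _ ↦ .inr (inv_pos.2 hs).le)

theorem norm_snd_le_homNorm_rpow (hs : 0 < s) (z : V × V) : ‖z.2‖ ≤ homNorm s z ^ s :=
  (Real.rpow_inv_le_iff_of_pos (norm_nonneg _) (homNorm_nonneg s z) hs).1 (le_max_right _ _)

theorem homNorm_pos (hs : 0 < s) {z : V × V} (hz : z ≠ 0) : 0 < homNorm s z := by
  refine (homNorm_nonneg s z).lt_of_ne' fun h ↦ hz ?_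
  have hfst : ‖z.1‖ ≤ 0 := h ▸ le_max_left _ _
  have hsnd : ‖z.2‖ ≤ 0 := by
    simpa only [h, Real.zero_rpow hs.ne'] using norm_snd_le_homNorm_rpow hs z
  exact Prod.ext (norm_le_zero_iff.1 hfst) (norm_le_zero_iff.1 hsnd)

theorem one_add_homNorm_le (hs : 0 < s) (z : V × V) :
    1 + homNorm s z ≤ 2 * (1 + ‖z‖) ^ (⌈s⁻¹⌉₊ + 1) := by
  have h1 : 1 ≤ 1 + ‖z‖ := le_add_of_nonneg_right (norm_nonneg z)
  have hfst : ‖z.1‖ ≤ (1 + ‖z‖) ^ (⌈s⁻¹⌉₊ + 1) :=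
    ((norm_fst_le z).trans (lt_one_add _).le).trans (le_self_pow₀ h1 (Nat.succ_ne_zero _))
  have hsnd : ‖z.2‖ ^ s⁻¹ ≤ (1 + ‖z‖) ^ (⌈s⁻¹⌉₊ + 1) :=
    rpow_le_one_add_pow_ceil (norm_nonneg _) (norm_snd_le z) (inv_pos.2 hs).le
  have : homNorm s z ≤ (1 + ‖z‖) ^ (⌈s⁻¹⌉₊ + 1) := max_le hfst hsnd
  linarith [one_le_pow₀ h1 (n := ⌈s⁻¹⌉₊ + 1)]

theorem one_add_norm_le (hs : 0 < s) (z : V × V) :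
    1 + ‖z‖ ≤ 2 * (1 + homNorm s z) ^ (⌈s⌉₊ + 1) := by
  have h1 : 1 ≤ 1 + homNorm s z := le_add_of_nonneg_right (homNorm_nonneg s z)
  have hfst : ‖z.1‖ ≤ (1 + homNorm s z) ^ (⌈s⌉₊ + 1) :=
    ((le_max_left _ _).trans (lt_one_add (homNorm s z)).le).trans
      (le_self_pow₀ h1 (Nat.succ_ne_zero _))
  have hsnd : ‖z.2‖ ≤ (1 + homNorm s z) ^ (⌈s⌉₊ + 1) :=
    (norm_snd_le_homNorm_rpow hs z).trans
      (rpow_le_one_add_pow_ceil (homNorm_nonneg s z) le_rfl hs.le)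
  have : ‖z‖ ≤ (1 + homNorm s z) ^ (⌈s⌉₊ + 1) := max_le hfst hsnd
  linarith [one_le_pow₀ h1 (n := ⌈s⌉₊ + 1)]

theorem exists_forall_homNorm_le_mem (hs : 0 < s) {U : Set (V × V)} (hU : U ∈ 𝓝 0) :
    ∃ δ > 0, ∀ z, homNorm s z ≤ δ → z ∈ U := by
  obtain ⟨ε, hε, hεU⟩ := Metric.nhds_basis_closedBall.mem_iff.1 hU
  refine ⟨min ε (ε ^ s⁻¹), lt_min hε (Real.rpow_pos_of_pos hε _), fun z hz ↦
    hεU (mem_closedBall_zero_iff.2 ?_)⟩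
  obtain ⟨h1, h2⟩ := max_le_iff.1 hz
  exact max_le (h1.trans (min_le_left _ _)) ((Real.rpow_le_rpow_iff (norm_nonneg _) hε.le
    (inv_pos.2 hs)).1 (h2.trans (min_le_right _ _)))

theorem isCompact_setOf_homNorm_le [ProperSpace V] (hs : 0 < s) (R : ℝ) :
    IsCompact {z : V × V | homNorm s z ≤ R} := by
  refine Metric.isCompact_of_isClosed_isBounded (isClosed_le (continuous_homNorm hs)
    continuous_const) (isBounded_iff_forall_norm_le.2 ⟨2 * (1 + R) ^ (⌈s⌉₊ + 1), fun z hz ↦ ?_⟩)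
  have h0 := homNorm_nonneg s z
  calc ‖z‖ ≤ 1 + ‖z‖ := by linarith
    _ ≤ 2 * (1 + homNorm s z) ^ (⌈s⌉₊ + 1) := one_add_norm_le hs z
    _ ≤ 2 * (1 + R) ^ (⌈s⌉₊ + 1) := by gcongr; exact hz

end HomNorm

section Dilation

variable {V : Type*} [NormedAddCommGroup V] [NormedSpace ℝ V]

theorem dilation_sub (s l : ℝ) (z w : V × V) :
    dilation s l (z - w) = dilation s l z - dilation s l w := by
  simp only [dilation, Prod.fst_sub, Prod.snd_sub, smul_sub, Prod.mk_sub_mk]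

theorem dilation_dilation_inv {l : ℝ} (hl : 0 < l) (s : ℝ) (z : V × V) :
    dilation s l (dilation s l⁻¹ z) = z := by
  rw [dilation, dilation, smul_inv_smul₀ hl.ne', Real.inv_rpow hl.le,
    smul_inv_smul₀ (Real.rpow_pos_of_pos hl s).ne']

theorem homNorm_dilation {s : ℝ} (hs : 0 < s) {l : ℝ} (hl : 0 ≤ l) (z : V × V) :
    homNorm s (dilation s l z) = l * homNorm s z := by
  rw [homNorm, homNorm, dilation, norm_smul, norm_smul, Real.norm_of_nonneg hl,
    Real.norm_of_nonneg (Real.rpow_nonneg hl s),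
    Real.mul_rpow (Real.rpow_nonneg hl s) (norm_nonneg _), Real.rpow_rpow_inv hl hs.ne',
    mul_max_of_nonneg _ _ hl]

end Dilation

/-! ### Rapid decay along dilations -/

section RapidDecayAt

variable {α β E A : Type*} [NormedAddCommGroup E] [NormedRing A]

/-- The family `f l` decays faster than any power of `l` as `l → ∞`, uniformly on `S`. -/
def RapidDecayOn (f : ℝ → α → E) (S : Set α) : Prop :=
  ∀ N : ℕ, ∃ C : ℝ, ∀ a ∈ S, ∀ l, 1 ≤ l → l ^ N * ‖f l a‖ ≤ C

theorem RapidDecayOn.union {f : ℝ → α → E} {S T : Set α} (hS : RapidDecayOn f S)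
    (hT : RapidDecayOn f T) : RapidDecayOn f (S ∪ T) := by
  intro N
  obtain ⟨C, hC⟩ := hS N
  obtain ⟨D, hD⟩ := hT N
  exact ⟨max C D, fun a ha l hl ↦ ha.elim (fun h ↦ (hC a h l hl).trans (le_max_left _ _))
    fun h ↦ (hD a h l hl).trans (le_max_right _ _)⟩

theorem RapidDecayOn.mono {f : ℝ → α → E} {S T : Set α} (hT : RapidDecayOn f T) (h : S ⊆ T) :
    RapidDecayOn f S := fun N ↦
  let ⟨C, hC⟩ := hT N
  ⟨C, fun a ha ↦ hC a (h ha)⟩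

variable [TopologicalSpace α] [TopologicalSpace β]

/-- The family `f l` decays faster than any power of `l` as `l → ∞`, uniformly near `a`. -/
def RapidDecayAt (f : ℝ → α → E) (a : α) : Prop := ∃ U ∈ 𝓝 a, RapidDecayOn f U

theorem RapidDecayAt.comp {f : ℝ → α → E} {g : β → α} {b : β} (hf : RapidDecayAt f (g b))
    (hg : Continuous g) : RapidDecayAt (fun l b ↦ f l (g b)) b := by
  obtain ⟨U, hU, hf⟩ := hf
  refine ⟨g ⁻¹' U, hg.continuousAt hU, fun N ↦ ?_⟩
  obtain ⟨C, hC⟩ := hf N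
  exact ⟨C, fun b hb ↦ hC (g b) hb⟩

theorem RapidDecayAt.of_norm_le {F : Type*} [NormedAddCommGroup F] {f : ℝ → α → E}
    {g : ℝ → α → F} {a : α} {C : ℝ} (hg : RapidDecayAt g a)
    (h : ∀ l b, ‖f l b‖ ≤ C * ‖g l b‖) : RapidDecayAt f a := by
  obtain ⟨U, hU, hg⟩ := hg
  refine ⟨U, hU, fun N ↦ ?_⟩
  obtain ⟨B, hB⟩ := hg N
  refine ⟨|C| * B, fun b hb l hl ↦ ?_⟩
  calc l ^ N * ‖f l b‖ ≤ l ^ N * (|C| * ‖g l b‖) := by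
        gcongr
        exact (h l b).trans (mul_le_mul_of_nonneg_right (le_abs_self C) (norm_nonneg _))
    _ = |C| * (l ^ N * ‖g l b‖) := by ring
    _ ≤ |C| * B := mul_le_mul_of_nonneg_left (hB b hb l hl) (abs_nonneg C)

theorem RapidDecayAt.mul {f g : ℝ → α → A} {a : α} (hf : RapidDecayAt f a)
    (hg : ∃ (m : ℕ) (C : ℝ), ∀ᶠ b in 𝓝 a, ∀ l, 1 ≤ l → ‖g l b‖ ≤ C * l ^ m) :
    RapidDecayAt (fun l b ↦ f l b * g l b) a := by
  obtain ⟨U, hU, hf⟩ := hf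
  obtain ⟨m, C, hg⟩ := hg
  refine ⟨_, inter_mem hU hg, fun N ↦ ?_⟩
  obtain ⟨B, hB⟩ := hf (N + m)
  refine ⟨B * |C|, fun b hb l hl ↦ ?_⟩
  calc l ^ N * ‖f l b * g l b‖ ≤ l ^ N * (‖f l b‖ * (|C| * l ^ m)) := by
        gcongr
        refine (norm_mul_le _ _).trans (mul_le_mul_of_nonneg_left ?_ (norm_nonneg _))
        exact (hb.2 l hl).trans (by gcongr; exact le_abs_self C)
    _ = l ^ (N + m) * ‖f l b‖ * |C| := by ring
    _ ≤ B * |C| := mul_le_mul_of_nonneg_right (hB b hb.1 l hl) (abs_nonneg C)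

theorem exists_rapidDecayOn_prod {f : ℝ → α × β → E} {a : α} {S : Set β} (hS : IsCompact S)
    (hf : ∀ b ∈ S, RapidDecayAt f (a, b)) : ∃ U ∈ 𝓝 a, RapidDecayOn f (U ×ˢ S) := by
  refine hS.induction_on (p := fun S ↦ ∃ U ∈ 𝓝 a, RapidDecayOn f (U ×ˢ S)) ?_ ?_ ?_ fun b hb ↦ ?_
  · exact ⟨Set.univ, univ_mem, fun _ ↦ ⟨0, by simp only [Set.prod_empty, Set.mem_empty_iff_false,
      false_imp_iff, implies_true]⟩⟩
  · rintro S T hST ⟨U, hU, hT⟩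
    exact ⟨U, hU, hT.mono (Set.prod_mono_right hST)⟩
  · rintro S T ⟨U, hU, hS⟩ ⟨W, hW, hT⟩
    refine ⟨U ∩ W, inter_mem hU hW, (hS.union hT).mono ?_⟩
    rw [Set.prod_union]
    exact Set.union_subset_union (Set.prod_mono_left Set.inter_subset_left)
      (Set.prod_mono_left Set.inter_subset_right)
  · obtain ⟨Q, hQ, hfQ⟩ := hf b hb
    obtain ⟨U, hU, W, hW, hUW⟩ := mem_nhds_prod_iff.1 hQ
    exact ⟨W, mem_nhdsWithin_of_mem_nhds hW, U, hU, hfQ.mono hUW⟩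

end RapidDecayAt

section DecayAlongDilations

variable {V W E : Type*} [NormedAddCommGroup V] [NormedAddCommGroup W] [NormedAddCommGroup E]
  {s : ℝ}

theorem PolyGrowth.exists_eventually_norm_comp_le {X Y : Type*} [NormedAddCommGroup X]
    [NormedAddCommGroup Y] {f : Y → E} (hf : PolyGrowth f) {g : ℝ → X → Y} {c : ℕ}
    (hg : ∀ l, 1 ≤ l → ∀ x, ‖g l x‖ ≤ l ^ c * ‖x‖) (a : X) :
    ∃ (m : ℕ) (C : ℝ), ∀ᶠ x in 𝓝 a, ∀ l, 1 ≤ l → ‖f (g l x)‖ ≤ C * l ^ m := by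
  obtain ⟨m, C, hC, hf⟩ := hf
  refine ⟨c * m, C * (2 + ‖a‖) ^ m, ?_⟩
  filter_upwards [continuous_norm.continuousAt.eventually_lt_const (lt_add_one ‖a‖)] with x hx l hl
  have hlc : 1 ≤ l ^ c := one_le_pow₀ hl
  have hgx : 1 + ‖g l x‖ ≤ (2 + ‖a‖) * l ^ c :=
    calc 1 + ‖g l x‖ ≤ l ^ c + l ^ c * (‖a‖ + 1) := by
          gcongr
          exact (hg l hl x).trans (by gcongr)
      _ = (2 + ‖a‖) * l ^ c := by ring
  calc ‖f (g l x)‖ ≤ C * (1 + ‖g l x‖) ^ m := hf _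
    _ ≤ C * ((2 + ‖a‖) * l ^ c) ^ m := by gcongr
    _ = C * (2 + ‖a‖) ^ m * l ^ (c * m) := by rw [mul_pow, pow_mul, mul_assoc]

theorem PolyGrowth.exists_norm_le_homNorm (hs : 0 < s) {F : (V × V) × (W × W) → E}
    (hF : PolyGrowth F) : ∃ (m : ℕ) (C : ℝ), 0 ≤ C ∧
      ∀ z w, ‖F (z, w)‖ ≤ C * ((1 + homNorm s z) * (1 + homNorm s w)) ^ m := by
  obtain ⟨m, C, hC, hF⟩ := hF
  refine ⟨(⌈s⌉₊ + 1) * m, C * 4 ^ m, by positivity, fun z w ↦ (hF _).trans ?_⟩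
  have hmax : 1 + ‖(z, w)‖ ≤ (1 + ‖z‖) * (1 + ‖w‖) := by
    have := max_le_add_of_nonneg (norm_nonneg z) (norm_nonneg w)
    rw [Prod.norm_mk]
    nlinarith [mul_nonneg (norm_nonneg z) (norm_nonneg w)]
  have hz := homNorm_nonneg s z
  calc C * (1 + ‖(z, w)‖) ^ m
      ≤ C * (2 * (1 + homNorm s z) ^ (⌈s⌉₊ + 1) * (2 * (1 + homNorm s w) ^ (⌈s⌉₊ + 1))) ^ m := by
        gcongr
        exact hmax.trans (by gcongr; exacts [one_add_norm_le hs z, one_add_norm_le hs w])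
    _ = C * 4 ^ m * ((1 + homNorm s z) * (1 + homNorm s w)) ^ ((⌈s⌉₊ + 1) * m) := by
      rw [show 2 * (1 + homNorm s z) ^ (⌈s⌉₊ + 1) * (2 * (1 + homNorm s w) ^ (⌈s⌉₊ + 1)) =
        4 * ((1 + homNorm s z) * (1 + homNorm s w)) ^ (⌈s⌉₊ + 1) by rw [mul_pow]; ring,
        mul_pow, pow_mul, mul_assoc]

variable [NormedSpace ℝ V] [NormedSpace ℝ W]

theorem norm_dilation_le (s : ℝ) {l : ℝ} (hl : 1 ≤ l) (z : V × V) :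
    ‖dilation s l z‖ ≤ l ^ (⌈s⌉₊ + 1) * ‖z‖ := by
  have h0 : 0 ≤ l := zero_le_one.trans hl
  refine max_le ?_ ?_
  · rw [dilation, norm_smul, Real.norm_of_nonneg h0]
    exact mul_le_mul (le_self_pow₀ hl (Nat.succ_ne_zero _)) (norm_fst_le z) (norm_nonneg _)
      (by positivity)
  · rw [dilation, norm_smul, Real.norm_of_nonneg (Real.rpow_nonneg h0 s)]
    refine mul_le_mul ?_ (norm_snd_le z) (norm_nonneg _) (by positivity)
    calc l ^ s ≤ l ^ ((⌈s⌉₊ + 1 : ℕ) : ℝ) := Real.rpow_le_rpow_of_exponent_le hl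
          ((Nat.le_ceil s).trans (mod_cast Nat.le_succ _))
      _ = l ^ (⌈s⌉₊ + 1) := Real.rpow_natCast _ _

theorem norm_prod_dilation_le (s : ℝ) {l : ℝ} (hl : 1 ≤ l) (p : (V × V) × (W × W)) :
    ‖(dilation s l p.1, dilation s l p.2)‖ ≤ l ^ (⌈s⌉₊ + 1) * ‖p‖ := by
  have h0 : 0 ≤ l ^ (⌈s⌉₊ + 1) := pow_nonneg (zero_le_one.trans hl) _
  exact max_le ((norm_dilation_le s hl _).trans (mul_le_mul_of_nonneg_left (norm_fst_le p) h0))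
    ((norm_dilation_le s hl _).trans (mul_le_mul_of_nonneg_left (norm_snd_le p) h0))

theorem RapidDecay.rapidDecayAt_dilation (hs : 0 < s) {f : V × V → E} (hf : RapidDecay f)
    {a : V × V} (ha : a ≠ 0) : RapidDecayAt (fun l z ↦ f (dilation s l z)) a := by
  set c := homNorm s a / 2
  have hc : 0 < c := half_pos (homNorm_pos hs ha)
  refine ⟨{z | c < homNorm s z}, (continuous_homNorm hs).continuousAt.eventually_const_lt
    (half_lt_self (homNorm_pos hs ha)), fun N ↦ ?_⟩
  obtain ⟨C, hC⟩ := hf ((⌈s⁻¹⌉₊ + 1) * N)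
  refine ⟨(2 / c) ^ N * C, fun z hz l hl ↦ ?_⟩
  have hl0 : 0 ≤ l := zero_le_one.trans hl
  have hlc : l ≤ 2 / c * (1 + ‖dilation s l z‖) ^ (⌈s⁻¹⌉₊ + 1) := by
    rw [div_mul_eq_mul_div, le_div_iff₀ hc]
    calc l * c ≤ l * homNorm s z := mul_le_mul_of_nonneg_left hz.le hl0
      _ = homNorm s (dilation s l z) := (homNorm_dilation hs hl0 z).symm
      _ ≤ 1 + homNorm s (dilation s l z) := (lt_one_add _).le
      _ ≤ 2 * (1 + ‖dilation s l z‖) ^ (⌈s⁻¹⌉₊ + 1) := one_add_homNorm_le hs _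
  calc l ^ N * ‖f (dilation s l z)‖
      ≤ (2 / c * (1 + ‖dilation s l z‖) ^ (⌈s⁻¹⌉₊ + 1)) ^ N * ‖f (dilation s l z)‖ := by gcongr
    _ = (2 / c) ^ N * ((1 + ‖dilation s l z‖) ^ ((⌈s⁻¹⌉₊ + 1) * N) * ‖f (dilation s l z)‖) := by
      rw [mul_pow, ← pow_mul, mul_assoc]
    _ ≤ (2 / c) ^ N * C := mul_le_mul_of_nonneg_left (hC _) (by positivity)

theorem exists_cone_decay [ProperSpace W] (hs : 0 < s) {F : (V × V) × (W × W) → E}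
    (h0 : ∀ w ≠ 0, RapidDecayAt (fun l p ↦ F (dilation s l p.1, dilation s l p.2)) (0, w)) :
    ∃ δ, 0 < δ ∧ δ ≤ 1 ∧ ∀ N : ℕ, ∃ C, ∀ z w, 1 ≤ homNorm s w →
      homNorm s z ≤ δ * homNorm s w → homNorm s w ^ N * ‖F (z, w)‖ ≤ C := by
  have hS : IsCompact {w : W × W | homNorm s w = 1} :=
    (isCompact_setOf_homNorm_le hs 1).of_isClosed_subset
      (isClosed_eq (continuous_homNorm hs) continuous_const) fun w hw ↦ hw.le
  obtain ⟨U, hU, hdecay⟩ := exists_rapidDecayOn_prod hS fun w hw ↦ h0 w fun h ↦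
    zero_ne_one ((homNorm_zero hs).symm.trans (h ▸ hw))
  obtain ⟨ε, hε, hεU⟩ := exists_forall_homNorm_le_mem hs hU
  refine ⟨min ε 1, lt_min hε one_pos, min_le_right _ _, fun N ↦ ?_⟩
  obtain ⟨C, hC⟩ := hdecay N
  refine ⟨C, fun z w hw hzw ↦ ?_⟩
  set g := homNorm s w
  have hg : 0 < g := one_pos.trans_le hw
  have hzU : dilation s g⁻¹ z ∈ U := hεU _ <| by
    rw [homNorm_dilation hs (inv_pos.2 hg).le, inv_mul_le_iff₀ hg, mul_comm]
    exact hzw.trans (mul_le_mul_of_nonneg_right (min_le_left _ _) hg.le)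
  have hwS : homNorm s (dilation s g⁻¹ w) = 1 := by
    rw [homNorm_dilation hs (inv_pos.2 hg).le, inv_mul_cancel₀ hg.ne']
  simpa only [dilation_dilation_inv hg] using
    hC (dilation s g⁻¹ z, dilation s g⁻¹ w) ⟨hzU, hwS⟩ g hw

theorem exists_homNorm_decay_snd [ProperSpace W] (hs : 0 < s) {F : (V × V) × (W × W) → E}
    (hF : PolyGrowth F)
    (h0 : ∀ w ≠ 0, RapidDecayAt (fun l p ↦ F (dilation s l p.1, dilation s l p.2)) (0, w))
    (N : ℕ) : ∃ (M : ℕ) (C : ℝ), 0 ≤ C ∧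
      ∀ z w, (1 + homNorm s w) ^ N * ‖F (z, w)‖ ≤ C * (1 + homNorm s z) ^ M := by
  obtain ⟨δ, hδ, hδ1, hcone⟩ := exists_cone_decay hs h0
  obtain ⟨m, A, hA, hgrowth⟩ := hF.exists_norm_le_homNorm hs
  obtain ⟨B, hB⟩ := hcone N
  refine ⟨m + (N + m), max (2 ^ N * B) (A * (2 / δ) ^ (N + m)), le_max_of_le_right (by positivity),
    fun z w ↦ ?_⟩
  have hz := homNorm_nonneg s z
  have hw := homNorm_nonneg s w
  by_cases h : 1 ≤ homNorm s w ∧ homNorm s z ≤ δ * homNorm s w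
  · calc (1 + homNorm s w) ^ N * ‖F (z, w)‖
        ≤ (2 * homNorm s w) ^ N * ‖F (z, w)‖ := by gcongr; linarith [h.1]
      _ = 2 ^ N * (homNorm s w ^ N * ‖F (z, w)‖) := by rw [mul_pow, mul_assoc]
      _ ≤ 2 ^ N * B := mul_le_mul_of_nonneg_left (hB z w h.1 h.2) (by positivity)
      _ ≤ max (2 ^ N * B) (A * (2 / δ) ^ (N + m)) := le_max_left _ _
      _ ≤ _ := le_mul_of_one_le_right (le_max_of_le_right (by positivity))
        (one_le_pow₀ (le_add_of_nonneg_right hz))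
  · have hwz : 1 + homNorm s w ≤ 2 / δ * (1 + homNorm s z) := by
      rw [div_mul_eq_mul_div, le_div_iff₀ hδ]
      rcases not_and_or.1 h with h | h <;> nlinarith
    calc (1 + homNorm s w) ^ N * ‖F (z, w)‖
        ≤ (1 + homNorm s w) ^ N * (A * ((1 + homNorm s z) * (1 + homNorm s w)) ^ m) := by
          gcongr
          exact hgrowth z w
      _ = A * (1 + homNorm s z) ^ m * (1 + homNorm s w) ^ (N + m) := by
        rw [mul_pow, pow_add]; ring
      _ ≤ A * (1 + homNorm s z) ^ m * (2 / δ * (1 + homNorm s z)) ^ (N + m) := by gcongr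
      _ = A * (2 / δ) ^ (N + m) * (1 + homNorm s z) ^ (m + (N + m)) := by
        rw [mul_pow, pow_add _ m]; ring
      _ ≤ _ := mul_le_mul_of_nonneg_right (le_max_right _ _) (by positivity)

theorem exists_decay_snd [ProperSpace W] (hs : 0 < s) {F : (V × V) × (W × W) → E}
    (hF : PolyGrowth F)
    (h0 : ∀ w ≠ 0, RapidDecayAt (fun l p ↦ F (dilation s l p.1, dilation s l p.2)) (0, w))
    (N : ℕ) : ∃ (M : ℕ) (C : ℝ), 0 ≤ C ∧
      ∀ z w, (1 + ‖w‖) ^ N * ‖F (z, w)‖ ≤ C * (1 + ‖z‖) ^ M := by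
  obtain ⟨M, C, hC, hF⟩ := exists_homNorm_decay_snd hs hF h0 ((⌈s⌉₊ + 1) * N)
  refine ⟨(⌈s⁻¹⌉₊ + 1) * M, 2 ^ N * (C * 2 ^ M), by positivity, fun z w ↦ ?_⟩
  have hz := homNorm_nonneg s z
  calc (1 + ‖w‖) ^ N * ‖F (z, w)‖
      ≤ (2 * (1 + homNorm s w) ^ (⌈s⌉₊ + 1)) ^ N * ‖F (z, w)‖ := by
        gcongr
        exact one_add_norm_le hs w
    _ = 2 ^ N * ((1 + homNorm s w) ^ ((⌈s⌉₊ + 1) * N) * ‖F (z, w)‖) := by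
      rw [mul_pow, ← pow_mul, mul_assoc]
    _ ≤ 2 ^ N * (C * (2 * (1 + ‖z‖) ^ (⌈s⁻¹⌉₊ + 1)) ^ M) := by
      refine mul_le_mul_of_nonneg_left ((hF z w).trans ?_) (by positivity)
      gcongr
      exact one_add_homNorm_le hs z
    _ = 2 ^ N * (C * 2 ^ M) * (1 + ‖z‖) ^ ((⌈s⁻¹⌉₊ + 1) * M) := by rw [mul_pow, ← pow_mul]; ring

theorem exists_decay_of_homNorm_le [ProperSpace W] (hs : 0 < s) {R : ℝ} (hR : 1 ≤ R)
    {F : (V × V) × (W × W) → E} {a : V × V}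
    (ha : ∀ w, RapidDecayAt (fun l p ↦ F (dilation s l p.1, dilation s l p.2)) (a, w)) :
    ∃ U ∈ 𝓝 a, ∀ M N : ℕ, ∃ C, ∀ z ∈ U, ∀ l, 1 ≤ l → ∀ w, homNorm s w ≤ l * R →
      (1 + homNorm s w) ^ M * (l ^ N * ‖F (dilation s l z, w)‖) ≤ C := by
  obtain ⟨U, hU, hdecay⟩ := exists_rapidDecayOn_prod (isCompact_setOf_homNorm_le hs R)
    fun w _ ↦ ha w
  refine ⟨U, hU, fun M N ↦ ?_⟩
  obtain ⟨A, hA⟩ := hdecay (M + N)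
  refine ⟨(1 + R) ^ M * A, fun z hz l hl w hw ↦ ?_⟩
  have hl0 : 0 < l := one_pos.trans_le hl
  have hw0 := homNorm_nonneg s w
  have hwS : homNorm s (dilation s l⁻¹ w) ≤ R := by
    rwa [homNorm_dilation hs (inv_pos.2 hl0).le, inv_mul_le_iff₀ hl0]
  have hA' : l ^ (M + N) * ‖F (dilation s l z, w)‖ ≤ A := by
    simpa only [dilation_dilation_inv hl0] using hA (z, dilation s l⁻¹ w) ⟨hz, hwS⟩ l hl
  calc (1 + homNorm s w) ^ M * (l ^ N * ‖F (dilation s l z, w)‖)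
      ≤ ((1 + R) * l) ^ M * (l ^ N * ‖F (dilation s l z, w)‖) := by gcongr; linarith
    _ = (1 + R) ^ M * (l ^ (M + N) * ‖F (dilation s l z, w)‖) := by rw [mul_pow, pow_add]; ring
    _ ≤ (1 + R) ^ M * A := by gcongr

theorem exists_joint_decay [ProperSpace W] (hs : 0 < s) {F : (V × V) × (W × W) → E}
    (h0 : ∀ w ≠ 0, RapidDecayAt (fun l p ↦ F (dilation s l p.1, dilation s l p.2)) (0, w))
    {a : V × V}
    (ha : ∀ w, RapidDecayAt (fun l p ↦ F (dilation s l p.1, dilation s l p.2)) (a, w)) :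
    ∃ U ∈ 𝓝 a, ∀ M N : ℕ, ∃ C, ∀ z ∈ U, ∀ l, 1 ≤ l → ∀ w,
      (1 + homNorm s w) ^ M * (l ^ N * ‖F (dilation s l z, w)‖) ≤ C := by
  obtain ⟨δ, hδ, hδ1, hcone⟩ := exists_cone_decay hs h0
  set R := (homNorm s a + 1) / δ
  have hδR : δ * R = homNorm s a + 1 := mul_div_cancel₀ _ hδ.ne'
  have hR : 1 ≤ R := by
    rw [one_le_div hδ]
    linarith [homNorm_nonneg s a]
  obtain ⟨U, hU, hdecay⟩ := exists_decay_of_homNorm_le hs hR ha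
  refine ⟨U ∩ {z | homNorm s z < homNorm s a + 1}, inter_mem hU
    ((continuous_homNorm hs).continuousAt.eventually_lt_const (lt_add_one _)), fun M N ↦ ?_⟩
  obtain ⟨A, hA⟩ := hdecay M N
  obtain ⟨B, hB⟩ := hcone (M + N)
  refine ⟨max A (2 ^ M * B), fun z ⟨hzU, hz⟩ l hl w ↦ ?_⟩
  have hl0 : 0 < l := one_pos.trans_le hl
  have hw0 := homNorm_nonneg s w
  rcases le_total (homNorm s w) (l * R) with hw | hw
  · exact (hA z hzU l hl w hw).trans (le_max_left _ _)
  · have hlw : l ≤ homNorm s w := (le_mul_of_one_le_right hl0.le hR).trans hw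
    have hzw : homNorm s (dilation s l z) ≤ δ * homNorm s w := by
      rw [homNorm_dilation hs hl0.le]
      calc l * homNorm s z ≤ l * (δ * R) := mul_le_mul_of_nonneg_left (hδR ▸ hz.le) hl0.le
        _ = δ * (l * R) := mul_left_comm _ _ _
        _ ≤ δ * homNorm s w := mul_le_mul_of_nonneg_left hw hδ.le
    calc (1 + homNorm s w) ^ M * (l ^ N * ‖F (dilation s l z, w)‖)
        ≤ (2 * homNorm s w) ^ M * (homNorm s w ^ N * ‖F (dilation s l z, w)‖) := by
          gcongr
          linarith
      _ = 2 ^ M * (homNorm s w ^ (M + N) * ‖F (dilation s l z, w)‖) := by ring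
      _ ≤ 2 ^ M * B := mul_le_mul_of_nonneg_left (hB _ w (hl.trans hlw) hzw) (by positivity)
      _ ≤ _ := le_max_right _ _

theorem RapidDecayAt.integral_norm [FiniteDimensional ℝ W] [MeasurableSpace W] [BorelSpace W]
    (μ : Measure (W × W)) [μ.IsAddHaarMeasure] (hs : 0 < s) {F : (V × V) × (W × W) → E}
    (h0 : ∀ w ≠ 0, RapidDecayAt (fun l p ↦ F (dilation s l p.1, dilation s l p.2)) (0, w))
    {a : V × V}
    (ha : ∀ w, RapidDecayAt (fun l p ↦ F (dilation s l p.1, dilation s l p.2)) (a, w)) :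
    RapidDecayAt (fun l z ↦ ∫ w, ‖F (dilation s l z, w)‖ ∂μ) a := by
  have : ProperSpace W := FiniteDimensional.proper_real W
  obtain ⟨U, hU, hdecay⟩ := exists_joint_decay hs h0 ha
  obtain ⟨D, A, -, hint⟩ := exists_integral_norm_le (F := ℝ) μ
  refine ⟨U, hU, fun N ↦ ?_⟩
  obtain ⟨C, hC⟩ := hdecay ((⌈s⌉₊ + 1) * D) N
  refine ⟨A * (2 ^ D * C), fun z hz l hl ↦ ?_⟩
  have hl0 : 0 ≤ l ^ N := pow_nonneg (zero_le_one.trans hl) N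
  have hweight : ∀ w, (1 + ‖w‖) ^ D * ‖l ^ N * ‖F (dilation s l z, w)‖‖ ≤ 2 ^ D * C := fun w ↦ by
    rw [Real.norm_of_nonneg (by positivity)]
    calc (1 + ‖w‖) ^ D * (l ^ N * ‖F (dilation s l z, w)‖)
        ≤ (2 * (1 + homNorm s w) ^ (⌈s⌉₊ + 1)) ^ D * (l ^ N * ‖F (dilation s l z, w)‖) := by
          gcongr
          exact one_add_norm_le hs w
      _ = 2 ^ D * ((1 + homNorm s w) ^ ((⌈s⌉₊ + 1) * D) *
            (l ^ N * ‖F (dilation s l z, w)‖)) := by rw [mul_pow, ← pow_mul, mul_assoc]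
      _ ≤ 2 ^ D * C := mul_le_mul_of_nonneg_left (hC z hz l hl w) (by positivity)
  rw [Real.norm_of_nonneg (integral_nonneg fun w ↦ norm_nonneg _), ← integral_const_mul]
  simpa only [norm_mul, norm_norm, Real.norm_of_nonneg hl0] using hint _ _ hweight

theorem RapidDecayAt.integral_norm_mul [FiniteDimensional ℝ W] [MeasurableSpace W] [BorelSpace W]
    (μ : Measure (W × W)) [μ.IsAddHaarMeasure] (hs : 0 < s) {K : (V × V) × (W × W) → ℂ}
    {G : W × W → ℂ} (hK : PolyGrowth K) (hG : PolyGrowth G)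
    (h0 : ∀ w ≠ 0, RapidDecayAt (fun l p ↦ K (dilation s l p.1, dilation s l p.2)) (0, w))
    {a : V × V}
    (ha : ∀ w, RapidDecayAt (fun l p ↦ K (dilation s l p.1, dilation s l p.2)) (a, w) ∨
      RapidDecayAt (fun l w ↦ G (dilation s l w)) w) :
    RapidDecayAt (fun l z ↦ ∫ w, ‖K (dilation s l z, w) * G w‖ ∂μ) a := by
  have hKG {p : (V × V) × (W × W)}
      (h : RapidDecayAt (fun l p ↦ K (dilation s l p.1, dilation s l p.2)) p) :
      RapidDecayAt (fun l p ↦ K (dilation s l p.1, dilation s l p.2) * G (dilation s l p.2)) p :=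
    h.mul <| (hG.comp (PolyGrowth.of_norm_le_norm norm_snd_le)).exists_eventually_norm_comp_le
      (f := fun q : (V × V) × (W × W) ↦ G q.2) (fun l hl ↦ norm_prod_dilation_le s hl) p
  refine RapidDecayAt.integral_norm μ hs (F := fun p ↦ K p * G p.2) (fun w hw ↦ hKG (h0 w hw))
    fun w ↦ (ha w).elim hKG fun h ↦ ?_
  have hGK := (h.comp (g := Prod.snd (α := V × V)) (b := (a, w)) continuous_snd).mul
    (hK.exists_eventually_norm_comp_le (fun l hl ↦ norm_prod_dilation_le s hl) (a, w))
  simpa only [mul_comm] using hGK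

end DecayAlongDilations

/-! ### The Gabor wave front set -/

section Wavefront

theorem norm_dilation_le_of_le_one {V : Type*} [NormedAddCommGroup V] [NormedSpace ℝ V] {s l : ℝ}
    (hs : 0 ≤ s) (hl0 : 0 ≤ l) (hl1 : l ≤ 1) (z : V × V) : ‖dilation s l z‖ ≤ ‖z‖ := by
  refine max_le ?_ ?_
  · rw [dilation, norm_smul, Real.norm_of_nonneg hl0]
    exact (mul_le_of_le_one_left (norm_nonneg _) hl1).trans (norm_fst_le z)
  · rw [dilation, norm_smul, Real.norm_of_nonneg (Real.rpow_nonneg hl0 s)]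
    exact (mul_le_of_le_one_left (norm_nonneg _) (Real.rpow_le_one hl0 hl1 hs)).trans
      (norm_snd_le z)

theorem PolyGrowth.rapidDecayAt_dilation_iff {V E : Type*} [NormedAddCommGroup V]
    [NormedSpace ℝ V] [NormedAddCommGroup E] {s : ℝ} (hs : 0 ≤ s) {f : V × V → E}
    (hf : PolyGrowth f) {a : V × V} :
    RapidDecayAt (fun l z ↦ f (dilation s l z)) a ↔ ∃ U : Set (V × V), IsOpen U ∧ a ∈ U ∧
      ∀ N : ℕ, ∃ C : ℝ, ∀ z ∈ U, ∀ l : ℝ, 0 < l → l ^ N * ‖f (dilation s l z)‖ ≤ C := by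
  constructor
  · rintro ⟨U, hU, hdecay⟩
    obtain ⟨m, B, hB, hf⟩ := hf
    have hnorm : ∀ᶠ z in 𝓝 a, ‖z‖ < ‖a‖ + 1 :=
      continuous_norm.continuousAt.eventually_lt_const (lt_add_one ‖a‖)
    obtain ⟨T, hT, hTo, haT⟩ := mem_nhds_iff.1 (inter_mem hU hnorm)
    refine ⟨T, hTo, haT, fun N ↦ ?_⟩
    obtain ⟨C, hC⟩ := hdecay N
    refine ⟨max C (B * (1 + (‖a‖ + 1)) ^ m), fun z hz l hl ↦ ?_⟩
    rcases le_total 1 l with hl1 | hl1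
    · exact le_max_of_le_left (hC z (hT hz).1 l hl1)
    · refine le_max_of_le_right ?_
      calc l ^ N * ‖f (dilation s l z)‖ ≤ ‖f (dilation s l z)‖ :=
            mul_le_of_le_one_left (norm_nonneg _) (pow_le_one₀ hl.le hl1)
        _ ≤ B * (1 + ‖dilation s l z‖) ^ m := hf _
        _ ≤ B * (1 + (‖a‖ + 1)) ^ m := by
          gcongr
          exact (norm_dilation_le_of_le_one hs hl.le hl1 z).trans (hT hz).2.le
  · rintro ⟨U, hU, haU, h⟩
    refine ⟨U, hU.mem_nhds haU, fun N ↦ ?_⟩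
    obtain ⟨C, hC⟩ := h N
    exact ⟨C, fun z hz l hl ↦ hC z hz l (one_pos.trans_le hl)⟩

variable {V : Type*} [NormedAddCommGroup V] [InnerProductSpace ℝ V] [FiniteDimensional ℝ V]
  [MeasurableSpace V] [BorelSpace V] {s : ℝ}

theorem mem_wavefront_iff (hs : 0 < s) {φ : 𝓢(V, ℂ)} {u : 𝓢'(V, ℂ)} {z : V × V} :
    z ∈ wavefront s φ u ↔
      z ≠ 0 ∧ ¬ RapidDecayAt (fun l z ↦ gaborCoeff φ u (dilation s l z)) z := by
  have hc : (((2 * Real.pi) ^ (-(Module.finrank ℝ V : ℝ) / 2) : ℝ) : ℂ) ≠ 0 := by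
    exact_mod_cast (by positivity : (2 * Real.pi) ^ (-(Module.finrank ℝ V : ℝ) / 2) ≠ 0)
  set c := (((2 * Real.pi) ^ (-(Module.finrank ℝ V : ℝ) / 2) : ℝ) : ℂ)
  have hgrowth : PolyGrowth fun z ↦ c * gaborCoeff φ u z :=
    PolyGrowth.mul ⟨0, ‖c‖, norm_nonneg c, fun z ↦ by rw [pow_zero, mul_one]⟩
      (polyGrowth_gaborCoeff φ u)
  refine and_congr_right fun _ ↦ not_congr ((hgrowth.rapidDecayAt_dilation_iff hs.le).symm.trans
    ⟨fun h ↦ h.of_norm_le (C := ‖c‖⁻¹) fun l z ↦ ?_, fun h ↦ h.of_norm_le fun l z ↦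
      (norm_mul _ _).le⟩)
  rw [norm_mul, inv_mul_cancel_left₀ (norm_ne_zero_iff.2 hc)]

theorem RapidDecayAt.change_window (hs : 0 < s) {φ : 𝓢(V, ℂ)} (hφ : φ ≠ 0) (ψ : 𝓢(V, ℂ))
    {u : 𝓢'(V, ℂ)} {a : V × V}
    (h : RapidDecayAt (fun l z ↦ gaborCoeff φ u (dilation s l z)) a) :
    RapidDecayAt (fun l z ↦ gaborCoeff ψ u (dilation s l z)) a := by
  set Θ := windowCoeff φ (conjugate ψ)
  have hΘ : RapidDecay Θ := rapidDecay_windowCoeff _ _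
  have hdiag {p : (V × V) × (V × V)} (hp : p.1 ≠ p.2) :
      RapidDecayAt (fun l p ↦ Θ (dilation s l p.2 - dilation s l p.1)) p := by
    simpa only [dilation_sub] using
      (hΘ.rapidDecayAt_dilation hs (sub_ne_zero.2 hp.symm)).comp
        (g := fun p : (V × V) × (V × V) ↦ p.2 - p.1) (b := p)
        (continuous_snd.sub continuous_fst)
  have hgrowth : PolyGrowth fun p : (V × V) × (V × V) ↦ Θ (p.2 - p.1) :=
    let ⟨C, hC⟩ := hΘ 0
    ⟨0, C, (mul_nonneg (by positivity) (norm_nonneg _)).trans (hC 0), fun p ↦ by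
      simpa only [pow_zero, one_mul, mul_one] using hC (p.2 - p.1)⟩
  have hint := RapidDecayAt.integral_norm_mul volume hs hgrowth (polyGrowth_gaborCoeff φ u)
    (fun w hw ↦ hdiag hw.symm) (a := a) fun w ↦ ?_
  · refine hint.of_norm_le (C := ‖windowConst φ‖) fun l z ↦
      (norm_gaborCoeff_le hφ ψ u _).trans_eq ?_
    rw [Real.norm_of_nonneg (integral_nonneg fun w ↦ norm_nonneg _)]
    simp_rw [norm_mul]; rfl
  · rcases eq_or_ne a w with rfl | haw
    · exact .inr h
    · exact .inl (hdiag haw)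

theorem wavefront_eq (hs : 0 < s) {φ ψ : 𝓢(V, ℂ)} (hφ : φ ≠ 0) (hψ : ψ ≠ 0) (u : 𝓢'(V, ℂ)) :
    wavefront s φ u = wavefront s ψ u := by
  ext z
  rw [mem_wavefront_iff hs, mem_wavefront_iff hs]
  exact and_congr_right fun _ ↦ not_congr
    ⟨fun h ↦ h.change_window hs hφ ψ, fun h ↦ h.change_window hs hψ φ⟩

theorem rapidDecayAt_gaborCoeff_of_notMem_wavefront (hs : 0 < s) {φ : 𝓢(V, ℂ)} (hφ : φ ≠ 0)
    (ψ : 𝓢(V, ℂ)) {u : 𝓢'(V, ℂ)} {a : V × V} (ha : a ≠ 0) (h : a ∉ wavefront s φ u) :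
    RapidDecayAt (fun l z ↦ gaborCoeff ψ u (dilation s l z)) a := by
  rw [mem_wavefront_iff hs, not_and, not_not] at h
  exact (h ha).change_window hs hφ ψ

theorem rapidDecayAt_apply_atom (hs : 0 < s) {φ : 𝓢(V, ℂ)} (hφ : φ ≠ 0) (χ : 𝓢(V, ℂ))
    {u : 𝓢'(V, ℂ)} {w : V × V} (hw : w ≠ 0) (h : (w.1, -w.2) ∉ wavefront s φ u) :
    RapidDecayAt (fun l w ↦ u (atom (dilation s l w) χ)) w := by
  have hne : (w.1, -w.2) ≠ (0 : V × V) := by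
    rwa [← norm_ne_zero_iff, norm_mk_neg, norm_ne_zero_iff]
  refine ((rapidDecayAt_gaborCoeff_of_notMem_wavefront hs hφ (conjugate χ) hne h).comp
    (g := fun w : V × V ↦ (w.1, -w.2)) (b := w) continuous_mk_neg).of_norm_le (C := 1) fun l w ↦ ?_
  rw [one_mul, ← gaborCoeff_conjugate, dilation, dilation, smul_neg]

end Wavefront

/-! ### Schwartz kernels -/

section Superposition

variable {X : Type*} [AddCommGroup X] [Module ℂ X] [TopologicalSpace X]

theorem exists_continuous_seminorm_mul_le {q : Seminorm ℂ X} (hq : Continuous q) (C : ℝ) :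
    ∃ p : Seminorm ℂ X, Continuous p ∧ ∀ x, C * q x ≤ p x :=
  ⟨C.toNNReal • q, continuous_const.mul hq, fun x ↦
    mul_le_mul_of_nonneg_right (Real.le_coe_toNNReal C) (apply_nonneg q x)⟩

variable {V : Type*} [NormedAddCommGroup V] [InnerProductSpace ℝ V] [FiniteDimensional ℝ V]
  [MeasurableSpace V] [BorelSpace V]

theorem RapidDecay.schwartzIntegrable_atom {χ : 𝓢(V, ℂ)} {u : 𝓢'(V, ℂ)}
    (h : RapidDecay (gaborCoeff χ u)) :
    SchwartzIntegrable volume (gaborCoeff χ u) fun w ↦ atom w χ :=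
  h.schwartzIntegrable (continuous_gaborCoeff χ u).aestronglyMeasurable (continuous_atom χ)
    fun k n ↦ polyGrowth_seminorm_atom _
      ((schwartz_withSeminorms ℂ V ℂ).continuous_seminorm (k, n)) χ

theorem exists_seminorm_schwartzIntegral_le {χ : 𝓢(V, ℂ)} {B : X → 𝓢'(V, ℂ)}
    (hI : ∀ x, SchwartzIntegrable volume (gaborCoeff χ (B x)) fun w ↦ atom w χ)
    (hB : ∀ N : ℕ, ∃ q : Seminorm ℂ X, Continuous q ∧ ∀ x w,
      (1 + ‖w‖) ^ N * ‖gaborCoeff χ (B x) w‖ ≤ q x) (k n : ℕ) :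
    ∃ p : Seminorm ℂ X, Continuous p ∧
      ∀ x, SchwartzMap.seminorm ℂ k n (schwartzIntegral (hI x)) ≤ p x := by
  obtain ⟨m, C, hC, hatom⟩ := polyGrowth_seminorm_atom _
    ((schwartz_withSeminorms ℂ V ℂ).continuous_seminorm (k, n)) χ
  obtain ⟨D, A, -, hint⟩ := exists_integral_norm_le (F := ℝ) (volume : Measure (V × V))
  obtain ⟨q, hq, hqB⟩ := hB (D + m)
  obtain ⟨p, hp, hqp⟩ := exists_continuous_seminorm_mul_le hq (A * C)
  refine ⟨p, hp, fun x ↦ (seminorm_schwartzIntegral_le (hI x) k n).trans ?_⟩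
  refine le_trans ?_ ((hint (fun w ↦ ‖gaborCoeff χ (B x) w‖ *
    SchwartzMap.seminorm ℂ k n (atom w χ)) (C * q x) fun w ↦ ?_).trans
      ((mul_assoc A C (q x)).symm.trans_le (hqp x)))
  · exact integral_mono_of_nonneg (ae_of_all _ fun w ↦ by positivity) ((hI x).integrable k n).norm
      (ae_of_all _ fun w ↦ le_abs_self _)
  · rw [norm_mul, norm_norm]
    calc _ ≤ (1 + ‖w‖) ^ D * (‖gaborCoeff χ (B x) w‖ * (C * (1 + ‖w‖) ^ m)) := by
          gcongr
          exact hatom w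
      _ = C * ((1 + ‖w‖) ^ (D + m) * ‖gaborCoeff χ (B x) w‖) := by ring
      _ ≤ C * q x := by gcongr; exact hqB x w

variable [IsTopologicalAddGroup X]

theorem exists_clm_apply_eq_integral {χ : 𝓢(V, ℂ)} (B : X →ₗ[ℂ] 𝓢'(V, ℂ))
    (hB : ∀ N : ℕ, ∃ q : Seminorm ℂ X, Continuous q ∧ ∀ x w,
      (1 + ‖w‖) ^ N * ‖gaborCoeff χ (B x) w‖ ≤ q x) :
    ∃ S : X →L[ℂ] 𝓢(V, ℂ), ∀ x (u : 𝓢'(V, ℂ)),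
      u (S x) = ∫ w, gaborCoeff χ (B x) w * u (atom w χ) := by
  have hI x : SchwartzIntegrable volume (gaborCoeff χ (B x)) fun w ↦ atom w χ :=
    RapidDecay.schwartzIntegrable_atom fun N ↦ let ⟨q, _, h⟩ := hB N; ⟨q x, h x⟩
  let S : X →ₗ[ℂ] 𝓢(V, ℂ) :=
    { toFun x := schwartzIntegral (hI x)
      map_add' x y := by
        ext t
        refine Eq.trans ?_ (integral_add ((hI x).integrable_mul_apply t)
          ((hI y).integrable_mul_apply t))
        change ∫ w, B (x + y) _ * atom w χ t = ∫ w, (B x _ * atom w χ t + B y _ * atom w χ t)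
        simp_rw [← add_mul, map_add]
        rfl
      map_smul' c x := by
        ext t
        refine Eq.trans ?_ (integral_const_mul c fun w ↦ gaborCoeff χ (B x) w * atom w χ t)
        change ∫ w, B (c • x) _ * atom w χ t = ∫ w, c * (B x _ * atom w χ t)
        simp_rw [← mul_assoc, map_smul]
        rfl }
  refine ⟨⟨S, (schwartz_withSeminorms ℂ V ℂ).continuous_of_continuous_comp S fun i ↦ ?_⟩,
    fun x u ↦ apply_schwartzIntegral (hI x) u⟩
  obtain ⟨p, hp, hle⟩ := exists_seminorm_schwartzIntegral_le hI hB i.1 i.2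
  exact Seminorm.continuous_of_le hp hle

end Superposition

section Kernel

variable {d : ℕ}

theorem tensor_conjugate_atom (χ : 𝓢(Rd d, ℂ)) (z w : Rd d × Rd d) :
    tensor (conjugate (atom z χ)) (conjugate (atom w χ)) =
      conjugate (atom (phasePoint z.1 w.1 z.2 w.2) (tensor χ χ)) := by
  ext t
  simp only [tensor_apply, conjugate_apply, atom_apply, phasePoint, ← map_mul]
  congr 1
  simp only [WithLp.prod_inner_apply, WithLp.sub_fst, WithLp.sub_snd, Complex.ofReal_add, add_mul,
    Complex.exp_add]
  change _ = Complex.exp (((inner ℝ t.fst z.2 : ℝ) : ℂ) * Complex.I) *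
    Complex.exp (((inner ℝ t.snd w.2 : ℝ) : ℂ) * Complex.I) *
      (χ (t.fst - z.1) * χ (t.snd - w.1))
  ring

theorem continuous_phasePoint :
    Continuous fun p : (Rd d × Rd d) × (Rd d × Rd d) ↦ phasePoint p.1.1 p.2.1 p.1.2 p.2.2 :=
  ((WithLp.prod_continuous_toLp 2 _ _).comp (by fun_prop)).prodMk
    ((WithLp.prod_continuous_toLp 2 _ _).comp (by fun_prop))

theorem phasePoint_eq_zero_iff {x y ξ η : Rd d} :
    phasePoint x y ξ η = 0 ↔ (x, ξ) = 0 ∧ (y, η) = 0 := by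
  simp only [phasePoint, Prod.mk_eq_zero, WithLp.toLp_eq_zero]
  tauto

theorem norm_toLp_le (x y : Rd d) : ‖(WithLp.toLp 2 (x, y) : R2d d)‖ ≤ ‖x‖ + ‖y‖ := by
  refine abs_le_of_sq_le_sq' ?_ (by positivity) |>.2
  rw [WithLp.prod_norm_sq_eq_of_L2]
  change ‖x‖ ^ 2 + ‖y‖ ^ 2 ≤ _
  nlinarith [mul_nonneg (norm_nonneg x) (norm_nonneg y)]

theorem norm_phasePoint_le (p : (Rd d × Rd d) × (Rd d × Rd d)) :
    ‖phasePoint p.1.1 p.2.1 p.1.2 p.2.2‖ ≤ 2 * ‖p‖ := by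
  have h : ‖phasePoint p.1.1 p.2.1 p.1.2 p.2.2‖ ≤ ‖p.1‖ + ‖p.2‖ :=
    max_le ((norm_toLp_le _ _).trans (add_le_add (norm_fst_le _) (norm_fst_le _)))
      ((norm_toLp_le _ _).trans (add_le_add (norm_snd_le _) (norm_snd_le _)))
  linarith [norm_fst_le p, norm_snd_le p]

/-- The Gabor coefficients of a kernel with respect to a tensor window, as a function of the pair
`((x, ξ), (y, η))` of phase space points. -/
def kernelCoeff (χ : 𝓢(Rd d, ℂ)) (K : 𝓢'(R2d d, ℂ)) (p : (Rd d × Rd d) × (Rd d × Rd d)) : ℂ :=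
  gaborCoeff (tensor χ χ) K (phasePoint p.1.1 p.2.1 p.1.2 p.2.2)

theorem kernelCoeff_mk (χ : 𝓢(Rd d, ℂ)) (K : 𝓢'(R2d d, ℂ)) (z w : Rd d × Rd d) :
    kernelCoeff χ K (z, w) = K (tensor (conjugate (atom z χ)) (conjugate (atom w χ))) := by
  rw [tensor_conjugate_atom]
  rfl

theorem polyGrowth_kernelCoeff (χ : 𝓢(Rd d, ℂ)) (K : 𝓢'(R2d d, ℂ)) :
    PolyGrowth (kernelCoeff χ K) :=
  (polyGrowth_gaborCoeff (tensor χ χ) K).comp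
    ⟨1, 2, zero_le_two, fun p ↦ by linarith [norm_phasePoint_le p]⟩

theorem rapidDecayAt_kernelCoeff {s : ℝ} (hs : 0 < s) {K : 𝓢'(R2d d, ℂ)} {Φ : 𝓢(R2d d, ℂ)}
    (hΦ : Φ ≠ 0) (χ : 𝓢(Rd d, ℂ)) {z w : Rd d × Rd d} (hzw : z = 0 → w ≠ 0)
    (h : phasePoint z.1 w.1 z.2 w.2 ∉ wavefront s Φ K) :
    RapidDecayAt (fun l p ↦ kernelCoeff χ K (dilation s l p.1, dilation s l p.2)) (z, w) := by
  have hne : phasePoint z.1 w.1 z.2 w.2 ≠ 0 := fun h0 ↦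
    hzw (phasePoint_eq_zero_iff.1 h0).1 (phasePoint_eq_zero_iff.1 h0).2
  exact (rapidDecayAt_gaborCoeff_of_notMem_wavefront hs hΦ (tensor χ χ) hne h).comp
    (g := fun p : (Rd d × Rd d) × (Rd d × Rd d) ↦ phasePoint p.1.1 p.2.1 p.1.2 p.2.2)
    (b := (z, w)) continuous_phasePoint

theorem rapidDecayAt_kernelCoeff_zero_left {s : ℝ} (hs : 0 < s) {K : 𝓢'(R2d d, ℂ)}
    {Φ : 𝓢(R2d d, ℂ)} (hΦ : Φ ≠ 0) (χ : 𝓢(Rd d, ℂ)) (hK₂ : secondAxis (wavefront s Φ K) = ∅)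
    {w : Rd d × Rd d} (hw : w ≠ 0) :
    RapidDecayAt (fun l p ↦ kernelCoeff χ K (dilation s l p.1, dilation s l p.2)) (0, w) := by
  refine rapidDecayAt_kernelCoeff hs hΦ χ (fun _ ↦ hw) fun hmem ↦ ?_
  refine (Set.eq_empty_iff_forall_notMem.1 hK₂) (w.1, -w.2) ?_
  change phasePoint 0 w.1 0 (- -w.2) ∈ wavefront s Φ K
  rwa [neg_neg]

/-- The operator `g ↦ K (g ⊗ ·)`, the transpose of `kernelOp K`. -/
def kernelTranspose (K : 𝓢'(R2d d, ℂ)) : 𝓢(Rd d, ℂ) →ₗ[ℂ] 𝓢'(Rd d, ℂ) where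
  toFun g := PointwiseConvergenceCLM.precomp ℂ (tensorRight g) K
  map_add' g₁ g₂ := by
    ext f
    exact map_add (kernelOp K f) g₁ g₂
  map_smul' c g := by
    ext f
    exact map_smul (kernelOp K f) c g

theorem gaborCoeff_kernelTranspose {χ : 𝓢(Rd d, ℂ)} (hχ : χ ≠ 0) (K : 𝓢'(R2d d, ℂ))
    (g : 𝓢(Rd d, ℂ)) (w : Rd d × Rd d) : gaborCoeff χ (kernelTranspose K g) w =
      windowConst χ * ∫ z, windowCoeff χ g z * kernelCoeff χ K (z, w) := by
  simp_rw [kernelCoeff_mk]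
  exact apply_eq_integral_windowCoeff hχ (kernelOp K (conjugate (atom w χ))) g

theorem gaborCoeff_kernelTranspose_conjugate_atom (χ : 𝓢(Rd d, ℂ)) (K : 𝓢'(R2d d, ℂ))
    (z w : Rd d × Rd d) :
    gaborCoeff χ (kernelTranspose K (conjugate (atom z χ))) w = kernelCoeff χ K (z, w) :=
  (kernelCoeff_mk χ K z w).symm

theorem exists_seminorm_gaborCoeff_kernelTranspose_le {s : ℝ} (hs : 0 < s) {K : 𝓢'(R2d d, ℂ)}
    {Φ : 𝓢(R2d d, ℂ)} (hΦ : Φ ≠ 0) {χ : 𝓢(Rd d, ℂ)} (hχ : χ ≠ 0)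
    (hK₂ : secondAxis (wavefront s Φ K) = ∅) (N : ℕ) :
    ∃ q : Seminorm ℂ 𝓢(Rd d, ℂ), Continuous q ∧ ∀ g w,
      (1 + ‖w‖) ^ N * ‖gaborCoeff χ (kernelTranspose K g) w‖ ≤ q g := by
  obtain ⟨M, C, hC, hK⟩ := exists_decay_snd hs (polyGrowth_kernelCoeff χ K)
    (fun w ↦ rapidDecayAt_kernelCoeff_zero_left hs hΦ χ hK₂) N
  obtain ⟨D, A, -, hint⟩ := exists_integral_norm_le (F := ℂ) (volume : Measure (Rd d × Rd d))
  obtain ⟨q, hq, hχq⟩ := exists_seminorm_windowCoeff_le χ (D + M)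
  obtain ⟨p, hp, hqp⟩ := exists_continuous_seminorm_mul_le hq (‖windowConst χ‖ * (A * C))
  refine ⟨p, hp, fun g w ↦ le_trans ?_ (hqp g)⟩
  rw [gaborCoeff_kernelTranspose hχ, norm_mul, mul_left_comm, mul_assoc, mul_assoc]
  refine mul_le_mul_of_nonneg_left ?_ (norm_nonneg _)
  have hweighted := hint
    (fun z ↦ ((1 + ‖w‖) ^ N : ℝ) • (windowCoeff χ g z * kernelCoeff χ K (z, w))) (C * q g)
      fun z ↦ ?_
  · refine le_trans ?_ hweighted
    simp_rw [norm_smul, integral_const_mul]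
    rw [Real.norm_of_nonneg (by positivity)]
    gcongr
    exact norm_integral_le_integral_norm _
  · rw [norm_smul, Real.norm_of_nonneg (by positivity), norm_mul]
    calc _ = (1 + ‖z‖) ^ D * ‖windowCoeff χ g z‖ * ((1 + ‖w‖) ^ N * ‖kernelCoeff χ K (z, w)‖) := by
          ring
      _ ≤ (1 + ‖z‖) ^ D * ‖windowCoeff χ g z‖ * (C * (1 + ‖z‖) ^ M) := by
          exact mul_le_mul_of_nonneg_left (hK z w) (by positivity)
      _ = C * ((1 + ‖z‖) ^ (D + M) * ‖windowCoeff χ g z‖) := by ring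
      _ ≤ C * q g := by gcongr; exact hχq g z

theorem exists_isExtension {s : ℝ} (hs : 0 < s) {K : 𝓢'(R2d d, ℂ)} {Φ : 𝓢(R2d d, ℂ)}
    (hΦ : Φ ≠ 0) {χ : 𝓢(Rd d, ℂ)} (hχ : χ ≠ 0) (hK₂ : secondAxis (wavefront s Φ K) = ∅) :
    ∃ T : 𝓢'(Rd d, ℂ) →ₗ[ℂ] 𝓢'(Rd d, ℂ), IsExtension K T ∧ ∀ u g, T u g =
      windowConst χ * ∫ w, gaborCoeff χ (kernelTranspose K g) w * u (atom w χ) := by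
  obtain ⟨S, hS⟩ := exists_clm_apply_eq_integral (kernelTranspose K)
    (exists_seminorm_gaborCoeff_kernelTranspose_le hs hΦ hχ hK₂)
  have hT (u : 𝓢'(Rd d, ℂ)) (g : 𝓢(Rd d, ℂ)) : u ((windowConst χ • S) g) =
      windowConst χ * ∫ w, gaborCoeff χ (kernelTranspose K g) w * u (atom w χ) := by
    rw [← hS]
    exact map_smul u (windowConst χ) (S g)
  let T : 𝓢'(Rd d, ℂ) →L[ℂ] 𝓢'(Rd d, ℂ) :=
    PointwiseConvergenceCLM.precomp ℂ (windowConst χ • S)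
  refine ⟨T.toLinearMap, ⟨T.continuous.seqContinuous, fun f ↦ ?_⟩, hT⟩
  ext g
  refine (hT (SchwartzMap.toTemperedDistributionCLM (Rd d) ℂ volume f) g).trans ?_
  simp_rw [toTemperedDistributionCLM_atom, mul_comm (gaborCoeff _ _ _)]
  exact (apply_eq_integral_windowCoeff hχ (kernelTranspose K g) f).symm

theorem IsExtension.unique {K : 𝓢'(R2d d, ℂ)} {T T' : 𝓢'(Rd d, ℂ) →ₗ[ℂ] 𝓢'(Rd d, ℂ)}
    (hT : IsExtension K T) (hT' : IsExtension K T') : T = T' := by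
  ext u g
  obtain ⟨f, hf⟩ := exists_seq_tendsto_toTemperedDistributionCLM u
  have hTf := hT.seqContinuous hf
  have hTf' := hT'.seqContinuous hf
  simp only [Function.comp_def, hT.extends_kernelOp, hT'.extends_kernelOp] at hTf hTf'
  rw [PointwiseConvergenceCLM.tendsto_iff_forall_tendsto] at hTf hTf'
  exact tendsto_nhds_unique (hTf g) (hTf' g)

theorem wavefront_subset_twistedComp {s : ℝ} (hs : 0 < s) {K : 𝓢'(R2d d, ℂ)} {Φ : 𝓢(R2d d, ℂ)}
    (hΦ : Φ ≠ 0) {χ : 𝓢(Rd d, ℂ)} (hK₁ : firstAxis (wavefront s Φ K) = ∅)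
    (hK₂ : secondAxis (wavefront s Φ K) = ∅) {u v : 𝓢'(Rd d, ℂ)} {φ : 𝓢(Rd d, ℂ)} (hφ : φ ≠ 0)
    (hv : ∀ g, v g =
      windowConst χ * ∫ w, gaborCoeff χ (kernelTranspose K g) w * u (atom w χ)) :
    wavefront s χ v ⊆ twistedComp (wavefront s Φ K) (wavefront s φ u) := by
  intro z hz
  by_contra hcomp
  obtain ⟨hz0, hndecay⟩ := (mem_wavefront_iff hs).1 hz
  refine hndecay ((RapidDecayAt.integral_norm_mul volume hs (polyGrowth_kernelCoeff χ K)
    (polyGrowth_apply_atom χ u)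
    (fun w ↦ rapidDecayAt_kernelCoeff_zero_left hs hΦ χ hK₂) (a := z) fun w ↦ ?_).of_norm_le
      (C := ‖windowConst χ‖) fun l z ↦ ?_)
  · by_cases hmem : phasePoint z.1 w.1 z.2 w.2 ∈ wavefront s Φ K
    · have hw : w ≠ 0 := by
        rintro rfl
        exact (Set.eq_empty_iff_forall_notMem.1 hK₁) z hmem
      refine .inr (rapidDecayAt_apply_atom hs hφ χ hw fun hwu ↦ hcomp ⟨_, hwu, ?_⟩)
      rwa [neg_neg]
    · exact .inl (rapidDecayAt_kernelCoeff hs hΦ χ (fun h ↦ (hz0 h).elim) hmem)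
  · rw [gaborCoeff, action, hv, norm_mul, Real.norm_of_nonneg (integral_nonneg fun w ↦
      norm_nonneg _)]
    simp_rw [gaborCoeff_kernelTranspose_conjugate_atom]
    gcongr
    exact norm_integral_le_integral_norm _

end Kernel

end

end GaborWF

/-- The wave front sets of `K`, `u` and `𝒦 u` are computed with arbitrary nonzero
windows `Φ`, `φ` and `ψ`. -/
theorem theorem4p4 (d : ℕ) (s : ℝ) (hs : 0 < s) (K : 𝓢'(GaborWF.R2d d, ℂ))
    (Φ : 𝓢(GaborWF.R2d d, ℂ)) (hΦ : Φ ≠ 0)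
    (hK₁ : GaborWF.firstAxis (GaborWF.wavefront s Φ K) = ∅)
    (hK₂ : GaborWF.secondAxis (GaborWF.wavefront s Φ K) = ∅) :
    (∃! T : 𝓢'(GaborWF.Rd d, ℂ) →ₗ[ℂ] 𝓢'(GaborWF.Rd d, ℂ), GaborWF.IsExtension K T) ∧
    ∀ T : 𝓢'(GaborWF.Rd d, ℂ) →ₗ[ℂ] 𝓢'(GaborWF.Rd d, ℂ), GaborWF.IsExtension K T →
      ∀ φ ψ : 𝓢(GaborWF.Rd d, ℂ), φ ≠ 0 → ψ ≠ 0 → ∀ u : 𝓢'(GaborWF.Rd d, ℂ),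
        GaborWF.wavefront s ψ (T u) ⊆
          GaborWF.twistedComp (GaborWF.wavefront s Φ K) (GaborWF.wavefront s φ u) := by
  obtain ⟨χ, hχ⟩ := GaborWF.exists_ne_zero (V := GaborWF.Rd d)
  obtain ⟨T₀, hT₀, hformula⟩ := GaborWF.exists_isExtension hs hΦ hχ hK₂
  refine ⟨⟨T₀, hT₀, fun T hT ↦ hT.unique hT₀⟩, fun T hT φ ψ hφ hψ u ↦ ?_⟩
  rw [hT.unique hT₀, GaborWF.wavefront_eq hs hψ hχ]
  exact GaborWF.wavefront_subset_twistedComp hs hΦ hK₁ hK₂ hφ (hformula u)
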